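/- Fix $n\ge 1$ and work over $\mathbf{C}$. Let $\mathscr{U}$ be the category whose objects are finite sets $S$ with a weight function $S\to\{1,\dots,n\}$ and whose morphisms are the bijections along which weights do not decrease; let $\mathscr{D}$ have the same objects and as morphisms the bijections along which weights do not increase, so that inverting bijections identifies $\mathscr{D}$ with $\mathscr{U}^{\mathrm{op}}$. A $\mathscr{U}$-module is a functor from $\mathscr{U}$ to finite dimensional complex vector spaces supported on finitely many objects up to isomorphism (similarly for $\mathscr{D}$). A tuple $\underline{a}=(a_1,\dots,a_n)\in\mathbf{N}^n$ is regarded as the weighted set having $a_i$ elements of weight $i$, and $|\underline{a}|=a_1+\cdots+a_n$. Let $\mathbf{P}_{\underline{a}}$ be the principal projective $\mathscr{U}$-module $T\mapsto\mathbf{C}[\mathrm{Hom}_{\mathscr{U}}(\underline{a},T)]$, let $\mathbf{J}_{\underline{a}}$ be the principal injective $\mathscr{D}$-module $T\mapsto\mathbf{C}[\mathrm{Hom}_{\mathscr{D}}(T,\underline{a})]^*$, and for a $\mathscr{D}$-module $N$ let $N^\vee$ be the $\mathscr{U}$-module $S\mapsto N(S)^*$. Let $\mathbf{V}$ be the vector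 space with basis $e_{i,j}$, $1\le i\le n$, $j\ge 1$, with the flag $0=\mathbf{V}_0\subset\mathbf{V}_1\subset\cdots\subset\mathbf{V}_n=\mathbf{V}$, where $\mathbf{V}_m$ is spanned by the $e_{i,j}$ with $i\le m$, and put $\mathbf{V}_{(i)}=\mathbf{V}_i/\mathbf{V}_{i-1}$. Let $\mathbf{G}$ be the group of linear automorphisms of $\mathbf{V}$ that fix all but finitely many of the basis vectors and preserve the flag. Put $$T_{\underline{a}}=\bigotimes_{i=1}^n(\mathbf{V}/\mathbf{V}_{i-1})^{\otimes a_i},$$ and for a morphism $\varphi:\underline{a}\to\underline{b}$ of $\mathscr{U}$ let $T_{\underline{a}}\to T_{\underline{b}}$ be the map of $\mathbf{G}$-representations that surjects the tensor factor of each element $x$ onto the tensor factor of $\varphi(x)$. Let $K_{\underline{a}}=\bigcap\ker(T_{\underline{a}}\to T_{\underline{b}})$, the intersection being over all non-isomorphisms $\underline{a}\to\underline{b}$ in $\mathscr{U}$. Write $\underline{a}\ge\underline{b}$ (dominance order) if $a_1+\cdots+a_i\ge b_1+\cdots+b_i$ for all $i$. Then for every $\underline{a}\in\mathbf{N}^n$: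 1. The functor $\underline{b}\mapsto\mathrm{Hom}_{\mathbf{G}}(T_{\underline{a}},T_{\underline{b}})$ is a $\mathscr{U}$-module, and it is isomorphic to $\mathbf{P}_{\underline{a}}$ via the natural map sending a morphism $\varphi:\underline{a}\to\underline{b}$ to the induced map $T_{\underline{a}}\to T_{\underline{b}}$; moreover $\mathbf{P}_{\underline{a}}\cong(\mathbf{J}_{\underline{a}})^\vee$ via the map sending $\varphi$ to evaluation at $\varphi^{-1}$. In particular, $\mathrm{Hom}_{\mathbf{G}}(T_{\underline{a}},T_{\underline{b}})\ne 0$ if and only if $|\underline{a}|=|\underline{b}|$ and $\underline{a}\ge\underline{b}$, and whenever $|\underline{a}|=|\underline{b}|$, $$\dim\mathrm{Hom}_{\mathbf{G}}(T_{\underline{a}},T_{\underline{b}})=b_1!\,b_2!\cdots b_n!\,\prod_{i=1}^{n-1}\binom{(a_1+\cdots+a_i)-(b_1+\cdots+b_{i-1})}{b_i}.$$ 2. $K_{\underline{a}}=\bigotimes_{i=1}^n\mathbf{V}_{(i)}^{\otimes a_i}$: the map $\bigotimes_{i}\mathbf{V}_{(i)}^{\otimes a_i}\to T_{\underline{a}}$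 induced by the inclusions $\mathbf{V}_{(i)}\subseteq\mathbf{V}/\mathbf{V}_{i-1}$ is an isomorphism of $\mathbf{G}$-representations onto $K_{\underline{a}}$. -/

import Mathlib

open CategoryTheory
open scoped TensorProduct

noncomputable section

namespace FlagRep

/-! ### Weighted finite sets; the categories of upwards and of downwards bijections -/

/-- An `[n]`-weighted finite set, with weights numbered `0, …, n - 1`; objects of the category `𝒰`
of upwards bijections. -/
structure USet (n : ℕ) where
  carrier : Type
  [finite : Finite carrier]
  weight : carrier → Fin n

/-- The same objects, for the category `𝒟` of downwards bijections. -/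
structure DSet (n : ℕ) where
  carrier : Type
  [finite : Finite carrier]
  weight : carrier → Fin n

attribute [instance] USet.finite DSet.finite

/-- A bijection along which weights do not decrease. -/
@[ext]
structure UHom {n : ℕ} (S T : USet n) where
  toEquiv : S.carrier ≃ T.carrier
  weight_le : ∀ x, S.weight x ≤ T.weight (toEquiv x)

/-- A bijection along which weights do not increase. -/
@[ext]
structure DHom {n : ℕ} (S T : DSet n) where
  toEquiv : S.carrier ≃ T.carrier
  weight_le : ∀ x, T.weight (toEquiv x) ≤ S.weight x

instance (n : ℕ) : Category (USet n) where
  Hom S T := UHom S T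
  id S := ⟨Equiv.refl _, fun _ => le_rfl⟩
  comp f g := ⟨f.toEquiv.trans g.toEquiv,
    fun x => (f.weight_le x).trans (g.weight_le (f.toEquiv x))⟩

instance (n : ℕ) : Category (DSet n) where
  Hom S T := DHom S T
  id S := ⟨Equiv.refl _, fun _ => le_rfl⟩
  comp f g := ⟨f.toEquiv.trans g.toEquiv,
    fun x => (g.weight_le (f.toEquiv x)).trans (f.weight_le x)⟩

/-- The weighted set `([a₁], …, [aₙ])` in `𝒰` attached to a tuple `a`. -/
def USet.ofTuple {n : ℕ} (a : Fin n → ℕ) : USet n where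
  carrier := Σ i : Fin n, Fin (a i)
  weight x := x.1

/-- The identification of objects of `𝒰` and `𝒟`. -/
def USet.toD {n : ℕ} (S : USet n) : DSet n where
  carrier := S.carrier
  finite := S.finite
  weight := S.weight

/-- The identification of `𝒟` with the opposite of `𝒰`: the inverse of an upwards bijection
is a downwards bijection. -/
def UHom.inv {n : ℕ} {S T : USet n} (f : S ⟶ T) : T.toD ⟶ S.toD where
  toEquiv := f.toEquiv.symm
  weight_le y := by
    have h := f.weight_le (f.toEquiv.symm y)
    exact h.trans (congrArg T.weight (f.toEquiv.apply_symm_apply y)).le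

/-! ### Modules over these categories -/

/-- A functor `C ⥤ Vec_ℂ` is a module over `C` if its values are finite dimensional and it is
supported on finitely many objects up to isomorphism. -/
structure IsFiniteModule {C : Type 1} [Category.{0} C] (M : C ⥤ ModuleCat.{0} ℂ) : Prop where
  finite_obj : ∀ S, Module.Finite ℂ (M.obj S)
  finite_support : ∃ F : Set C, F.Finite ∧
    ∀ S, Nontrivial (M.obj S) → ∃ T ∈ F, Nonempty (S ≅ T)

/-- The principal projective `P_a : T ↦ ℂ[Hom_𝒰(a, T)]`. -/
def princProj {n : ℕ} (a : USet n) : USet n ⥤ ModuleCat.{0} ℂ where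
  obj T := ModuleCat.of ℂ ((a ⟶ T) →₀ ℂ)
  map f := ModuleCat.ofHom (Finsupp.lmapDomain ℂ ℂ (fun φ => φ ≫ f))
  map_id T := by
    ext : 1
    simp only [Category.comp_id]
    exact Finsupp.lmapDomain_id ℂ ℂ
  map_comp f g := by
    ext : 1
    simp only [← Category.assoc]
    exact Finsupp.lmapDomain_comp ℂ ℂ (fun φ => φ ≫ f) (fun φ => φ ≫ g)

/-- The principal injective `𝒟`-module `J_a : T ↦ ℂ[Hom_𝒟(T, a)]^*`. -/
def princInj {n : ℕ} (a : DSet n) : DSet n ⥤ ModuleCat.{0} ℂ where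
  obj T := ModuleCat.of ℂ (Module.Dual ℂ ((T ⟶ a) →₀ ℂ))
  map f := ModuleCat.ofHom (Finsupp.lmapDomain ℂ ℂ (fun φ => f ≫ φ)).dualMap
  map_id T := by
    ext : 1
    simp only [Category.id_comp]
    exact (congrArg LinearMap.dualMap (Finsupp.lmapDomain_id ℂ ℂ)).trans LinearMap.dualMap_id
  map_comp f g := by
    ext : 1
    simp only [Category.assoc]
    exact (congrArg LinearMap.dualMap
      (Finsupp.lmapDomain_comp ℂ ℂ (fun φ => g ≫ φ) (fun φ => f ≫ φ))).trans
      (LinearMap.dualMap_comp_dualMap _ _).symm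

/-- The dual `N^∨ : S ↦ N(S)^*` of a `𝒟`-module `N`, a `𝒰`-module. -/
def dualOfD {n : ℕ} (N : DSet n ⥤ ModuleCat.{0} ℂ) : USet n ⥤ ModuleCat.{0} ℂ where
  obj S := ModuleCat.of ℂ (Module.Dual ℂ (N.obj S.toD))
  map f := ModuleCat.ofHom (N.map (UHom.inv f)).hom.dualMap
  map_id S := by
    have h : UHom.inv (𝟙 S) = 𝟙 S.toD := rfl
    rw [h, N.map_id]
    rfl
  map_comp f g := by
    have h : UHom.inv (f ≫ g) = UHom.inv g ≫ UHom.inv f := rfl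
    rw [h, N.map_comp]
    rfl

/-! ### Generalities on representations -/

/-- The tensor product of a family of representations. -/
def tensorRep {G ι : Type} [Group G] {M : ι → Type} [∀ i, AddCommGroup (M i)]
    [∀ i, Module ℂ (M i)] (ρ : ∀ i, Representation ℂ G (M i)) :
    Representation ℂ G (⨂[ℂ] i, M i) where
  toFun g := PiTensorProduct.map fun i => ρ i g
  map_one' := by
    simp only [map_one]
    exact PiTensorProduct.map_one
  map_mul' g h := by
    simp only [map_mul]
    exact PiTensorProduct.map_mul _ _

lemma tensorRep_tprod {G ι : Type} [Group G] {M : ι → Type} [∀ i, AddCommGroup (M i)]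
    [∀ i, Module ℂ (M i)] (ρ : ∀ i, Representation ℂ G (M i)) (g : G) (v : ∀ i, M i) :
    tensorRep ρ g (PiTensorProduct.tprod ℂ v) = PiTensorProduct.tprod ℂ fun i => ρ i g (v i) :=
  PiTensorProduct.map_tprod _ _

/-- The tensor product of a family of equivariant maps. -/
def tensorMap {G ι : Type} [Group G] {M N : ι → Type} [∀ i, AddCommGroup (M i)]
    [∀ i, Module ℂ (M i)] [∀ i, AddCommGroup (N i)] [∀ i, Module ℂ (N i)]
    {ρ : ∀ i, Representation ℂ G (M i)} {σ : ∀ i, Representation ℂ G (N i)}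
    (f : ∀ i, (ρ i).IntertwiningMap (σ i)) : (tensorRep ρ).IntertwiningMap (tensorRep σ) :=
  ⟨PiTensorProduct.map fun i => (f i).toLinearMap, fun g => by
    apply PiTensorProduct.ext
    apply MultilinearMap.ext
    intro v
    simp only [LinearMap.compMultilinearMap_apply, LinearMap.comp_apply, tensorRep_tprod,
      PiTensorProduct.map_tprod]
    congr 1
    funext i
    exact LinearMap.congr_fun ((f i).2 g) (v i)⟩

/-- Given representations `ρ m` and equivariant maps `ρ l → ρ m` for `l ≤ m`, the map
`⨂_{x ∈ X} ρ (w x) → ⨂_{y ∈ Y} ρ (w' y)` induced by a bijection `e : X ≃ Y` with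
`w x ≤ w' (e x)`: the tensor factor at `x` is mapped to the tensor factor at `e x`. -/
def transport {G X Y : Type} [Group G] {M : ℕ → Type} [∀ m, AddCommGroup (M m)]
    [∀ m, Module ℂ (M m)] {ρ : ∀ m, Representation ℂ G (M m)}
    (p : ∀ l m, l ≤ m → (ρ l).IntertwiningMap (ρ m)) {w : X → ℕ} {w' : Y → ℕ} (e : X ≃ Y)
    (h : ∀ y, w (e.symm y) ≤ w' y) :
    (tensorRep fun x => ρ (w x)).IntertwiningMap (tensorRep fun y => ρ (w' y)) :=
  ⟨PiTensorProduct.map (fun y => (p _ _ (h y)).toLinearMap) ∘ₗ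
    (PiTensorProduct.reindex ℂ (fun x => M (w x)) e).toLinearMap, fun g => by
    apply PiTensorProduct.ext
    apply MultilinearMap.ext
    intro v
    simp only [LinearMap.compMultilinearMap_apply, LinearMap.comp_apply, tensorRep_tprod,
      PiTensorProduct.map_tprod, LinearEquiv.coe_coe, PiTensorProduct.reindex_tprod]
    congr 1
    funext y
    exact LinearMap.congr_fun ((p _ _ (h y)).2 g) (v (e.symm y))⟩

lemma transport_tprod {G X Y : Type} [Group G] {M : ℕ → Type} [∀ m, AddCommGroup (M m)]
    [∀ m, Module ℂ (M m)] {ρ : ∀ m, Representation ℂ G (M m)}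
    (p : ∀ l m, l ≤ m → (ρ l).IntertwiningMap (ρ m)) {w : X → ℕ} {w' : Y → ℕ} (e : X ≃ Y)
    (h : ∀ y, w (e.symm y) ≤ w' y) (v : ∀ x, M (w x)) :
    (transport p e h).toLinearMap (PiTensorProduct.tprod ℂ v) =
      PiTensorProduct.tprod ℂ fun y => (p _ _ (h y)).toLinearMap (v (e.symm y)) := by
  simp only [transport, LinearMap.comp_apply, LinearEquiv.coe_coe,
    PiTensorProduct.reindex_tprod, PiTensorProduct.map_tprod]

lemma transport_refl {G X : Type} [Group G] {M : ℕ → Type} [∀ m, AddCommGroup (M m)]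
    [∀ m, Module ℂ (M m)] {ρ : ∀ m, Representation ℂ G (M m)}
    (p : ∀ l m, l ≤ m → (ρ l).IntertwiningMap (ρ m))
    (p_refl : ∀ m v, (p m m le_rfl).toLinearMap v = v) {w : X → ℕ} :
    transport p (w := w) (w' := w) (Equiv.refl X) (fun _ => le_rfl) = .id _ := by
  apply Representation.IntertwiningMap.toLinearMap_injective
  apply PiTensorProduct.ext
  apply MultilinearMap.ext
  intro v
  change (transport p (Equiv.refl X) fun _ => le_rfl).toLinearMap (PiTensorProduct.tprod ℂ v) =
    PiTensorProduct.tprod ℂ v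
  rw [transport_tprod]
  congr 1
  funext y
  exact p_refl _ _

lemma transport_trans {G X Y Z : Type} [Group G] {M : ℕ → Type} [∀ m, AddCommGroup (M m)]
    [∀ m, Module ℂ (M m)] {ρ : ∀ m, Representation ℂ G (M m)}
    (p : ∀ l m, l ≤ m → (ρ l).IntertwiningMap (ρ m))
    (p_trans : ∀ l m k (h : l ≤ m) (h' : m ≤ k) v,
      (p m k h').toLinearMap ((p l m h).toLinearMap v) = (p l k (h.trans h')).toLinearMap v)
    {w : X → ℕ} {w' : Y → ℕ} {w'' : Z → ℕ} (e : X ≃ Y) (e' : Y ≃ Z)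
    (h : ∀ y, w (e.symm y) ≤ w' y) (h' : ∀ z, w' (e'.symm z) ≤ w'' z)
    (h'' : ∀ z, w ((e.trans e').symm z) ≤ w'' z) :
    transport p (e.trans e') h'' = (transport p e' h').comp (transport p e h) := by
  apply Representation.IntertwiningMap.toLinearMap_injective
  apply PiTensorProduct.ext
  apply MultilinearMap.ext
  intro v
  change (transport p (e.trans e') h'').toLinearMap (PiTensorProduct.tprod ℂ v) =
    (transport p e' h').toLinearMap ((transport p e h).toLinearMap (PiTensorProduct.tprod ℂ v))
  simp only [transport_tprod]
  congr 1
  funext y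
  exact (p_trans _ _ _ _ _ _).symm

/-- The surjection `V / W → V / W'` for subrepresentations `W ≤ W'` of `V`. -/
def quotFactor {G V : Type} [Group G] [AddCommGroup V] [Module ℂ V] (ρ : Representation ℂ G V)
    {W W' : Submodule ℂ V} (hW : ∀ g, W ≤ W.comap (ρ g)) (hW' : ∀ g, W' ≤ W'.comap (ρ g))
    (h : W ≤ W') : (ρ.quotient W hW).IntertwiningMap (ρ.quotient W' hW') :=
  ⟨Submodule.factor h, fun g => by
    apply LinearMap.ext
    intro v
    obtain ⟨v, rfl⟩ := Submodule.Quotient.mk_surjective _ v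
    rfl⟩

lemma quotFactor_refl {G V : Type} [Group G] [AddCommGroup V] [Module ℂ V]
    (ρ : Representation ℂ G V) {W : Submodule ℂ V} (hW : ∀ g, W ≤ W.comap (ρ g)) (v : V ⧸ W) :
    (quotFactor ρ hW hW le_rfl).toLinearMap v = v := by
  obtain ⟨v, rfl⟩ := Submodule.Quotient.mk_surjective _ v
  rfl

lemma quotFactor_trans {G V : Type} [Group G] [AddCommGroup V] [Module ℂ V]
    (ρ : Representation ℂ G V) {W W' W'' : Submodule ℂ V} (hW : ∀ g, W ≤ W.comap (ρ g))
    (hW' : ∀ g, W' ≤ W'.comap (ρ g)) (hW'' : ∀ g, W'' ≤ W''.comap (ρ g)) (h : W ≤ W')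
    (h' : W' ≤ W'') (v : V ⧸ W) :
    (quotFactor ρ hW' hW'' h').toLinearMap ((quotFactor ρ hW hW' h).toLinearMap v) =
      (quotFactor ρ hW hW'' (h.trans h')).toLinearMap v := by
  obtain ⟨v, rfl⟩ := Submodule.Quotient.mk_surjective _ v
  rfl

/-- For subrepresentations `W ≤ U` of `V`, the representation `U / W`. -/
def subquotRep {G V : Type} [Group G] [AddCommGroup V] [Module ℂ V] (ρ : Representation ℂ G V)
    {W U : Submodule ℂ V} (hW : ∀ g, W ≤ W.comap (ρ g)) (hU : ∀ g, U ≤ U.comap (ρ g)) :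
    Representation ℂ G (U ⧸ W.comap U.subtype) :=
  (ρ.subrepresentation U hU).quotient (W.comap U.subtype) fun g _ hv => hW g hv

/-- The inclusion `U / W → V / W`. -/
def subquotIncl {G V : Type} [Group G] [AddCommGroup V] [Module ℂ V] (ρ : Representation ℂ G V)
    {W U : Submodule ℂ V} (hW : ∀ g, W ≤ W.comap (ρ g)) (hU : ∀ g, U ≤ U.comap (ρ g)) :
    (subquotRep ρ hW hU).IntertwiningMap (ρ.quotient W hW) :=
  ⟨Submodule.mapQ (W.comap U.subtype) W U.subtype le_rfl, fun g => by
    apply LinearMap.ext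
    intro v
    obtain ⟨v, rfl⟩ := Submodule.Quotient.mk_surjective _ v
    rfl⟩

/-! ### The standard representation, its flag, and the infinite rank parabolic group -/

/-- The standard representation `𝐕`: finitely supported functions on the index set of the basis
`e_{i,j}`, `i ∈ Fin n`, `j ∈ ℕ`. -/
def StdV (n : ℕ) : Type := (Fin n × ℕ) →₀ ℂ

instance (n : ℕ) : AddCommGroup (StdV n) := inferInstanceAs (AddCommGroup ((Fin n × ℕ) →₀ ℂ))

instance (n : ℕ) : Module ℂ (StdV n) := inferInstanceAs (Module ℂ ((Fin n × ℕ) →₀ ℂ))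

/-- The basis `e_{i,j}` of `𝐕`. -/
def stdE (n : ℕ) : Module.Basis (Fin n × ℕ) ℂ (StdV n) :=
  Module.Basis.ofRepr (LinearEquiv.refl ℂ ((Fin n × ℕ) →₀ ℂ))

/-- The `m`-th step `𝐕_m` of the flag, `0 ≤ m ≤ n`, spanned by the vectors of the first `m`
blocks. -/
def flag (n m : ℕ) : Submodule ℂ (StdV n) :=
  Submodule.span ℂ (stdE n '' {p | p.1.val < m})

lemma flag_mono (n : ℕ) {l m : ℕ} (h : l ≤ m) : flag n l ≤ flag n m :=
  Submodule.span_mono (Set.image_mono fun _ hp => lt_of_lt_of_le hp h)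

/-- `𝐆𝐋 = ⋃ᵢ GLᵢ(ℂ)`: the linear automorphisms of `𝐕` that fix all but finitely many basis
vectors. -/
def GLInf (n : ℕ) : Subgroup (StdV n ≃ₗ[ℂ] StdV n) where
  carrier := {g | {p | g (stdE n p) ≠ stdE n p}.Finite}
  mul_mem' := by
    intro g h hg hh
    refine (hg.union hh).subset fun p hp => ?_
    by_contra hc
    simp only [Set.mem_union, Set.mem_ofPred_eq, not_or, not_not] at hc
    exact hp (by rw [LinearEquiv.mul_apply, hc.2, hc.1])
  one_mem' := by simp
  inv_mem' := by
    intro g hg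
    refine Set.Finite.subset hg fun p hp hc => hp ?_
    change g.symm (stdE n p) = stdE n p
    rw [LinearEquiv.symm_apply_eq, hc]

/-- The automorphisms of `𝐕` that preserve the flag. -/
def flagStab (n : ℕ) : Subgroup (StdV n ≃ₗ[ℂ] StdV n) where
  carrier := {g | ∀ m, (flag n m).map g.toLinearMap = flag n m}
  mul_mem' := by
    intro g h hg hh m
    have e : (g * h).toLinearMap = g.toLinearMap ∘ₗ h.toLinearMap := rfl
    rw [e, Submodule.map_comp, hh m, hg m]
  one_mem' := fun m => Submodule.map_id _
  inv_mem' := by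
    intro g hg m
    have e : (g⁻¹).toLinearMap ∘ₗ g.toLinearMap = LinearMap.id :=
      LinearMap.ext fun v => g.symm_apply_apply v
    conv_lhs => rw [← hg m, ← Submodule.map_comp, e, Submodule.map_id]

/-- The group `𝐆` of invertible block upper triangular matrices. -/
def Gpar (n : ℕ) : Subgroup (StdV n ≃ₗ[ℂ] StdV n) := GLInf n ⊓ flagStab n

/-- The standard representation of `𝐆` on `𝐕`. -/
def stdRep (n : ℕ) : Representation ℂ (Gpar n) (StdV n) where
  toFun g := g.1.toLinearMap
  map_one' := rfl
  map_mul' _ _ := rfl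

lemma flag_le_comap (n m : ℕ) (g : Gpar n) : flag n m ≤ (flag n m).comap (stdRep n g) :=
  Submodule.map_le_iff_le_comap.mp (g.2.2 m).le

/-- The underlying space of `𝐕 / 𝐕_m`. -/
def QuotV (n m : ℕ) : Type := StdV n ⧸ flag n m

instance (n m : ℕ) : AddCommGroup (QuotV n m) := inferInstanceAs (AddCommGroup (StdV n ⧸ flag n m))

instance (n m : ℕ) : Module ℂ (QuotV n m) := inferInstanceAs (Module ℂ (StdV n ⧸ flag n m))

/-- The representation `𝐕 / 𝐕_m`. -/
def quotRep (n m : ℕ) : Representation ℂ (Gpar n) (QuotV n m) :=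
  (stdRep n).quotient (flag n m) (flag_le_comap n m)

/-- The surjection `𝐕 / 𝐕_l → 𝐕 / 𝐕_m` for `l ≤ m`. -/
def proj (n l m : ℕ) (h : l ≤ m) : (quotRep n l).IntertwiningMap (quotRep n m) :=
  quotFactor (stdRep n) (flag_le_comap n l) (flag_le_comap n m) (flag_mono n h)

lemma proj_refl (n m : ℕ) (v : QuotV n m) : (proj n m m le_rfl).toLinearMap v = v :=
  quotFactor_refl (stdRep n) (flag_le_comap n m) v

lemma proj_trans (n l m k : ℕ) (h : l ≤ m) (h' : m ≤ k) (v : QuotV n l) :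
    (proj n m k h').toLinearMap ((proj n l m h).toLinearMap v) =
      (proj n l k (h.trans h')).toLinearMap v :=
  quotFactor_trans (stdRep n) (flag_le_comap n l) (flag_le_comap n m) (flag_le_comap n k)
    (flag_mono n h) (flag_mono n h') v

/-- The underlying space of the graded piece `𝐕_{m+1} / 𝐕_m`. -/
def GrV (n m : ℕ) : Type := flag n (m + 1) ⧸ (flag n m).comap (flag n (m + 1)).subtype

instance (n m : ℕ) : AddCommGroup (GrV n m) :=
  inferInstanceAs (AddCommGroup (flag n (m + 1) ⧸ (flag n m).comap (flag n (m + 1)).subtype))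

instance (n m : ℕ) : Module ℂ (GrV n m) :=
  inferInstanceAs (Module ℂ (flag n (m + 1) ⧸ (flag n m).comap (flag n (m + 1)).subtype))

/-- The representation `𝐕_{m+1} / 𝐕_m`. -/
def grRep (n m : ℕ) : Representation ℂ (Gpar n) (GrV n m) :=
  subquotRep (stdRep n) (flag_le_comap n m) (flag_le_comap n (m + 1))

/-- The inclusion `𝐕_{m+1} / 𝐕_m → 𝐕 / 𝐕_m`. -/
def grIncl (n m : ℕ) : (grRep n m).IntertwiningMap (quotRep n m) :=
  subquotIncl (stdRep n) (flag_le_comap n m) (flag_le_comap n (m + 1))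

/-! ### The representations `T_a` and `K_a` -/

/-- The representation `T_S = ⨂_{x ∈ S} 𝐕 / 𝐕_{i-1}`, where `i` is the weight of `x` in the
numbering `1, …, n`. For the tuple `a` this is `⨂ᵢ (𝐕 / 𝐕_{i-1})^{⊗ aᵢ}`. -/
def TRep {n : ℕ} (S : USet n) : Rep.{0} ℂ (Gpar n) :=
  Rep.of (tensorRep fun x : S.carrier => quotRep n (S.weight x).val)

lemma weight_symm_le {n : ℕ} {S T : USet n} (f : S ⟶ T) (y : T.carrier) :
    (S.weight (f.toEquiv.symm y)).val ≤ (T.weight y).val := by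
  have h := f.weight_le (f.toEquiv.symm y)
  rw [Equiv.apply_symm_apply] at h
  exact h

/-- The map `T_S → T_T` attached to `f : S ⟶ T`: the tensor factor at `x` is surjected onto the
tensor factor at `f x`. -/
def TMap {n : ℕ} {S T : USet n} (f : S ⟶ T) : TRep S ⟶ TRep T :=
  Rep.ofHom (transport (proj n) (w := fun x => (S.weight x).val) (w' := fun y => (T.weight y).val)
    f.toEquiv (weight_symm_le f))

/-- The functor `𝒯 : 𝒰 ⥤ Rep(𝐆)`, `a ↦ T_a`. -/
def TFunctor (n : ℕ) : USet n ⥤ Rep.{0} ℂ (Gpar n) where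
  obj S := TRep S
  map f := TMap f
  map_id S := congrArg (fun F => Rep.ofHom F)
    (transport_refl (proj n) (proj_refl n) (w := fun x : S.carrier => (S.weight x).val))
  map_comp {R S T} f g := congrArg (fun F => Rep.ofHom F)
    (transport_trans (proj n) (proj_trans n) (w := fun x => (R.weight x).val)
      (w' := fun x => (S.weight x).val) (w'' := fun x => (T.weight x).val) f.toEquiv g.toEquiv
      (weight_symm_le f) (weight_symm_le g) (weight_symm_le (f ≫ g)))

/-- The `𝒰`-module `b ↦ Hom_𝐆(T_a, T_b)`, with `𝒰` acting by post-composition. -/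
def homT {n : ℕ} (a : USet n) : USet n ⥤ ModuleCat.{0} ℂ :=
  TFunctor n ⋙ (linearCoyoneda ℂ (Rep.{0} ℂ (Gpar n))).obj (Opposite.op ((TFunctor n).obj a))

/-- The subspace `⋂ ker (T_a → T_b)` of `T_a`, over all non-isomorphisms `a ⟶ b` in `𝒰`. -/
def KSub {n : ℕ} (a : USet n) : Submodule ℂ ((TFunctor n).obj a) :=
  ⨅ (b : USet n) (f : a ⟶ b) (_ : ¬ IsIso f), LinearMap.ker ((TFunctor n).map f).hom.toLinearMap

lemma KSub_le_comap {n : ℕ} (a : USet n) (g : Gpar n) :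
    KSub a ≤ (KSub a).comap (((TFunctor n).obj a).ρ g) := by
  intro v hv
  simp only [KSub, Submodule.mem_comap, Submodule.mem_iInf, LinearMap.mem_ker] at hv ⊢
  intro b f hf
  have h := Rep.hom_comm_apply ((TFunctor n).map f) g v
  have h' : ((TFunctor n).map f).hom v = 0 := hv b f hf
  rw [h', map_zero] at h
  exact h

/-- The representation `K_a`. -/
def KRep {n : ℕ} (a : USet n) : Rep.{0} ℂ (Gpar n) :=
  Rep.subrepresentation ((TFunctor n).obj a) (KSub a) (KSub_le_comap a)

/-- The inclusion `K_a → T_a`. -/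
def KIncl {n : ℕ} (a : USet n) : KRep a ⟶ (TFunctor n).obj a :=
  Rep.subtype ((TFunctor n).obj a) (KSub a) (KSub_le_comap a)

/-- The representation `⨂_{x ∈ S} 𝐕_{(i)}`, where `i` is the weight of `x`. For the tuple `a`
this is `⨂ᵢ 𝐕_{(i)}^{⊗ aᵢ}`. -/
def GrTRep {n : ℕ} (S : USet n) : Rep.{0} ℂ (Gpar n) :=
  Rep.of (tensorRep fun x : S.carrier => grRep n (S.weight x).val)

/-- The map `⨂ 𝐕_{(i)} → ⨂ 𝐕 / 𝐕_{i-1}` induced by the inclusions `𝐕_{(i)} ⊆ 𝐕 / 𝐕_{i-1}`. -/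
def grTIncl {n : ℕ} (S : USet n) : GrTRep S ⟶ (TFunctor n).obj S :=
  Rep.ofHom (tensorMap fun x : S.carrier => grIncl n (S.weight x).val)

/-! ### Dominance order -/

/-- `a ≥ b` for tuples with the same sum in the dominance order: every partial sum of `a` is at
least that of `b`. -/
def Dominates {n : ℕ} (a b : Fin n → ℕ) : Prop :=
  ∀ i, ∑ j ∈ Finset.Iic i, b j ≤ ∑ j ∈ Finset.Iic i, a j

end FlagRep

end

open FlagRep

/-! The monomials in the `e_{i,j}` form a basis of `T_S`, and everything is read off from their
coordinates under the elements of `𝐆` that send `e_p` to `e_p + e_{p'}`, where the block of `p'` is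
at most that of `p`.

Let `L` be the last block and `t = ⨂ e_{L, j x}` with `j` injective. A vector of block `L` can be
sheared towards every basis vector, so `g - 1` replaces one factor of `t` by an arbitrary one, and
`t` generates `T_S` (`eq_top_of_tBasis_topIdx_mem`). Hence an equivariant `F : T_S → T_T` is
determined by `F t`. Doubling one `e_p` acts on monomials through the multiplicity of `e_p`, so `F
t` only involves rearrangements of `t` along bijections `S ≃ T` (`exists_equiv_of_repr_ne_zero`). If
such a bijection lowered a weight, some shear would fix `t` but not `F t`
(`weight_le_of_repr_ne_zero`). The remaining bijections are the morphisms of `𝒰`; they send `t` to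
distinct monomials, so they form a basis of the Hom space (`homMap_bijective`).

Duality with `J_S` is inversion of bijections followed by the double dual of a finite dimensional
space. The dimension counts injections `b → a` that do not raise weights, chosen block by block from
the lowest (`card_embedding_of_monotone`).

For the kernel, a non-isomorphism strictly raises some weight and so kills the corresponding
`𝐕_{(i)}`. Conversely, a monomial with a factor in a block above its weight survives in `T_T`, where
`T` is `S` reweighted by the blocks of that monomial; so no element of the kernel involves it
(`weight_eq_of_mem_KSub`). -/

noncomputable section

namespace FlagRep

/-! ### Elementary elements of `𝐆` and coordinates on `𝐕 / 𝐕_m` -/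

/-- The endomorphism of `𝐕` sending `e_p` to `e_p + c e_{p'}` and fixing the other basis vectors. -/
def shear (n : ℕ) (p p' : Fin n × ℕ) (c : ℂ) : StdV n →ₗ[ℂ] StdV n :=
  LinearMap.id + c • ((stdE n).coord p).smulRight (stdE n p')

lemma shear_apply {n : ℕ} (p p' : Fin n × ℕ) (c : ℂ) (v : StdV n) :
    shear n p p' c v = v + (c * (stdE n).repr v p) • stdE n p' := by
  simp [shear, smul_smul]

/-- The `p`-coordinate of `e_{p'}` is `1` or `0` according to whether `p = p'`, so the composite is
the shear with coefficient the left side of `h`. -/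
lemma shear_shear {n : ℕ} (p p' : Fin n × ℕ) {c d : ℂ}
    (h : c + d + c * d * (if p = p' then 1 else 0) = 0) (v : StdV n) :
    shear n p p' c (shear n p p' d v) = v := by
  have hr : (stdE n).repr (stdE n p') p = if p = p' then 1 else 0 := by
    rw [Module.Basis.repr_self, Finsupp.single_apply]
    simp only [eq_comm]
  rw [shear_apply p p' c, shear_apply p p' d, map_add, map_smul, Finsupp.add_apply,
    Finsupp.smul_apply, smul_eq_mul, hr, add_assoc, ← add_smul, add_eq_left]
  convert zero_smul ℂ _
  linear_combination ((stdE n).repr v p) * h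

lemma mem_flag_iff {n m : ℕ} {v : StdV n} :
    v ∈ flag n m ↔ ∀ p, m ≤ p.1.val → (stdE n).repr v p = 0 := by
  rw [flag, Module.Basis.mem_span_image]
  constructor
  · intro h p hp
    by_contra hc
    exact absurd (h (Finsupp.mem_support_iff.mpr hc)) (not_lt.mpr hp)
  · intro h p hp
    by_contra hc
    exact Finsupp.mem_support_iff.mp hp (h p (not_lt.mp hc))

/-- Only the `p'`-coordinate changes; if `p'` lies outside the first `m` blocks then so does `p`,
and the added term vanishes. -/
lemma shear_mem_flag {n : ℕ} {p p' : Fin n × ℕ} (h : p'.1 ≤ p.1) (c : ℂ) {m : ℕ} {v : StdV n}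
    (hv : v ∈ flag n m) : shear n p p' c v ∈ flag n m := by
  rw [mem_flag_iff] at *
  intro r hr
  rw [shear_apply, map_add, map_smul, Finsupp.add_apply, Finsupp.smul_apply, hv r hr,
    Module.Basis.repr_self, Finsupp.single_apply]
  split_ifs with hrp
  · subst hrp
    rw [hv p (hr.trans h)]
    simp
  · simp

/-- The coefficient of the inverse of `shear n p p' 1`. -/
def shearInv {n : ℕ} (p p' : Fin n × ℕ) : ℂ := if p = p' then -1 / 2 else -1

/-- For `p = p'` the shear doubles `e_p`, so the inverse halves it, and `1 + (-1/2) = 1/2`; for `p ≠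
p'` it is unipotent. -/
lemma shearInv_left {n : ℕ} (p p' : Fin n × ℕ) :
    shearInv p p' + 1 + shearInv p p' * 1 * (if p = p' then 1 else 0) = 0 := by
  unfold shearInv; split_ifs <;> norm_num

lemma shearInv_right {n : ℕ} (p p' : Fin n × ℕ) :
    1 + shearInv p p' + 1 * shearInv p p' * (if p = p' then 1 else 0) = 0 := by
  unfold shearInv; split_ifs <;> norm_num

/-- The automorphism of `𝐕` sending `e_p` to `e_p + e_{p'}` and fixing the other basis vectors. -/
def shearEquiv {n : ℕ} (p p' : Fin n × ℕ) : StdV n ≃ₗ[ℂ] StdV n :=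
  { shear n p p' 1 with
    invFun := shear n p p' (shearInv p p')
    left_inv := fun v => shear_shear p p' (shearInv_left p p') v
    right_inv := fun v => shear_shear p p' (shearInv_right p p') v }

lemma shearEquiv_apply {n : ℕ} (p p' : Fin n × ℕ) (v : StdV n) :
    shearEquiv p p' v = shear n p p' 1 v := rfl

lemma shearEquiv_mem_Gpar {n : ℕ} {p p' : Fin n × ℕ} (h : p'.1 ≤ p.1) :
    shearEquiv p p' ∈ Gpar n := by
  refine ⟨?_, fun m => le_antisymm ?_ ?_⟩
  · change {r | shearEquiv p p' (stdE n r) ≠ stdE n r}.Finite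
    refine (Set.finite_singleton p).subset fun r hr => ?_
    by_contra hc
    refine hr ?_
    rw [shearEquiv_apply, shear_apply, Module.Basis.repr_self, Finsupp.single_apply,
      if_neg (Set.mem_singleton_iff.not.mp hc)]
    simp
  · rintro _ ⟨v, hv, rfl⟩
    exact shear_mem_flag h 1 hv
  · intro v hv
    exact ⟨shear n p p' (shearInv p p') v, shear_mem_flag h _ hv,
      shear_shear p p' (shearInv_right p p') v⟩

/-- The element of `𝐆` sending `e_p` to `e_p + e_{p'}` and fixing the other basis vectors. -/
def elt {n : ℕ} {p p' : Fin n × ℕ} (h : p'.1 ≤ p.1) : Gpar n :=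
  ⟨shearEquiv p p', shearEquiv_mem_Gpar h⟩

lemma stdRep_elt {n : ℕ} {p p' : Fin n × ℕ} (h : p'.1 ≤ p.1) (v : StdV n) :
    stdRep n (elt h) v = v + (stdE n).repr v p • stdE n p' :=
  (shear_apply p p' 1 v).trans (by rw [one_mul])

/-- The quotient map `𝐕 → 𝐕 / 𝐕_m`. -/
def quotMk (n m : ℕ) : StdV n →ₗ[ℂ] QuotV n m := (flag n m).mkQ

lemma quotMk_surjective (n m : ℕ) : Function.Surjective (quotMk n m) :=
  Submodule.mkQ_surjective _

lemma quotMk_eq_zero {n m : ℕ} {v : StdV n} : quotMk n m v = 0 ↔ v ∈ flag n m :=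
  Submodule.Quotient.mk_eq_zero _

lemma quotRep_quotMk (n m : ℕ) (g : Gpar n) (v : StdV n) :
    quotRep n m g (quotMk n m v) = quotMk n m (stdRep n g v) := rfl

lemma proj_quotMk {n l m : ℕ} (h : l ≤ m) (v : StdV n) :
    (proj n l m h).toLinearMap (quotMk n l v) = quotMk n m v := rfl

/-- The coordinates on `𝐕 / 𝐕_m`. -/
def quotCoord (n m : ℕ) : QuotV n m →ₗ[ℂ] ({p : Fin n × ℕ // m ≤ p.1.val} →₀ ℂ) :=
  (flag n m).liftQ
    (Finsupp.lsubtypeDomain {p : Fin n × ℕ | m ≤ p.1.val} ∘ₗ (stdE n).repr.toLinearMap) (by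
      intro v hv
      rw [LinearMap.mem_ker]
      ext p
      exact mem_flag_iff.mp hv p.1 p.2)

lemma quotCoord_quotMk {n m : ℕ} (v : StdV n) (p : {p : Fin n × ℕ // m ≤ p.1.val}) :
    quotCoord n m (quotMk n m v) p = (stdE n).repr v p := rfl

lemma quotCoord_injective (n m : ℕ) : Function.Injective (quotCoord n m) := by
  rw [injective_iff_map_eq_zero]
  intro v hv
  obtain ⟨v, rfl⟩ := quotMk_surjective n m v
  rw [quotMk_eq_zero, mem_flag_iff]
  intro p hp
  exact DFunLike.congr_fun hv ⟨p, hp⟩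

/-- The basis of `𝐕 / 𝐕_m` given by the images of the `e_{i,j}` outside `𝐕_m`. -/
def quotBasis (n m : ℕ) : Module.Basis {p : Fin n × ℕ // m ≤ p.1.val} ℂ (QuotV n m) :=
  .ofRepr (LinearEquiv.ofBijective (quotCoord n m) ⟨quotCoord_injective n m, fun f => by
    refine ⟨quotMk n m ((stdE n).repr.symm (f.mapDomain Subtype.val)), ?_⟩
    ext p
    rw [quotCoord_quotMk, LinearEquiv.apply_symm_apply,
      Finsupp.mapDomain_apply Subtype.val_injective]⟩)

lemma quotBasis_repr_quotMk {n m : ℕ} (v : StdV n) (p : {p : Fin n × ℕ // m ≤ p.1.val}) :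
    (quotBasis n m).repr (quotMk n m v) p = (stdE n).repr v p := rfl

lemma quotBasis_apply {n m : ℕ} (p : {p : Fin n × ℕ // m ≤ p.1.val}) :
    quotBasis n m p = quotMk n m (stdE n p) := by
  apply (quotBasis n m).repr.injective
  ext q
  rw [quotBasis_repr_quotMk, Module.Basis.repr_self, Module.Basis.repr_self,
    Finsupp.single_apply, Finsupp.single_apply]
  simp only [Subtype.ext_iff]

lemma quotBasis_repr_elt_of_ne {n m : ℕ} {p p' : Fin n × ℕ} (h : p'.1 ≤ p.1) (v : QuotV n m)
    {r : {p : Fin n × ℕ // m ≤ p.1.val}} (hr : r.1 ≠ p') :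
    (quotBasis n m).repr (quotRep n m (elt h) v) r = (quotBasis n m).repr v r := by
  obtain ⟨v, rfl⟩ := quotMk_surjective n m v
  rw [quotRep_quotMk, stdRep_elt, quotBasis_repr_quotMk, quotBasis_repr_quotMk, map_add, map_smul,
    Finsupp.add_apply, Finsupp.smul_apply, Module.Basis.repr_self, Finsupp.single_apply,
    if_neg (Ne.symm hr), smul_zero, add_zero]

/-- The case `p = p'` is allowed: the coordinate then doubles, which gives `tBasis_repr_elt_self`.
-/
lemma quotBasis_repr_elt {n m : ℕ} {p p' : Fin n × ℕ} (h : p'.1 ≤ p.1) (v : QuotV n m)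
    (hp : m ≤ p.1.val) (hp' : m ≤ p'.1.val) :
    (quotBasis n m).repr (quotRep n m (elt h) v) ⟨p', hp'⟩ =
      (quotBasis n m).repr v ⟨p', hp'⟩ + (quotBasis n m).repr v ⟨p, hp⟩ := by
  obtain ⟨v, rfl⟩ := quotMk_surjective n m v
  rw [quotRep_quotMk, stdRep_elt]
  simp only [quotBasis_repr_quotMk]
  rw [map_add, map_smul, Finsupp.add_apply, Finsupp.smul_apply, Module.Basis.repr_self,
    Finsupp.single_apply, if_pos rfl, smul_eq_mul, mul_one]

lemma quotBasis_repr_proj {n l m : ℕ} (h : l ≤ m) (v : QuotV n l)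
    (r : {p : Fin n × ℕ // m ≤ p.1.val}) :
    (quotBasis n m).repr ((proj n l m h).toLinearMap v) r =
      (quotBasis n l).repr v ⟨r.1, h.trans r.2⟩ := by
  obtain ⟨v, rfl⟩ := quotMk_surjective n l v
  rfl

/-! ### Coordinates on `T_S` -/

/-- The representation `T_S`, unbundled. -/
abbrev tRep {n : ℕ} (S : USet n) :
    Representation ℂ (Gpar n) (⨂[ℂ] x : S.carrier, QuotV n (S.weight x).val) :=
  tensorRep fun x : S.carrier => quotRep n (S.weight x).val

/-- The index set of the monomial basis of `T_S`. -/
abbrev TIdx {n : ℕ} (S : USet n) : Type :=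
  ∀ x : S.carrier, {p : Fin n × ℕ // (S.weight x).val ≤ p.1.val}

/-- The monomial basis of `T_S`. -/
def tBasis {n : ℕ} (S : USet n) :
    Module.Basis (TIdx S) ℂ (⨂[ℂ] x : S.carrier, QuotV n (S.weight x).val) :=
  Basis.piTensorProduct fun x => quotBasis n (S.weight x).val

lemma tBasis_apply {n : ℕ} {S : USet n} (q : TIdx S) :
    tBasis S q = PiTensorProduct.tprod ℂ fun x => quotMk n (S.weight x).val (stdE n (q x).1) := by
  rw [tBasis, Basis.piTensorProduct_apply]
  simp only [quotBasis_apply]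

lemma tBasis_repr_tprod {n : ℕ} {S : USet n} [Fintype S.carrier]
    (v : ∀ x : S.carrier, QuotV n (S.weight x).val) (q : TIdx S) :
    (tBasis S).repr (PiTensorProduct.tprod ℂ v) q =
      ∏ x, (quotBasis n (S.weight x).val).repr (v x) (q x) :=
  Basis.piTensorProduct_repr_tprod_apply _ _ _

/-- Doubling `e_p` is diagonal in the monomial basis, and its eigenvalue records how often `e_p`
occurs. -/
lemma tBasis_repr_elt_self {n : ℕ} {S : USet n} [Fintype S.carrier] (p : Fin n × ℕ)
    (u : ⨂[ℂ] x : S.carrier, QuotV n (S.weight x).val) (q : TIdx S) :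
    (tBasis S).repr (tRep S (elt (le_refl p.1)) u) q =
      2 ^ (Finset.univ.filter fun x => (q x).1 = p).card * (tBasis S).repr u q := by
  suffices h : (tBasis S).coord q ∘ₗ tRep S (elt (le_refl p.1)) =
      (2 ^ (Finset.univ.filter fun x => (q x).1 = p).card : ℂ) • (tBasis S).coord q from
    LinearMap.congr_fun h u
  apply PiTensorProduct.ext
  apply MultilinearMap.ext
  intro v
  simp only [LinearMap.compMultilinearMap_apply, LinearMap.comp_apply, tensorRep_tprod,
    Module.Basis.coord_apply, tBasis_repr_tprod, LinearMap.smul_apply, smul_eq_mul]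
  rw [Finset.card_filter, ← Finset.prod_pow_eq_pow_sum, ← Finset.prod_mul_distrib]
  refine Finset.prod_congr rfl fun x _ => ?_
  by_cases hx : (q x).1 = p
  · have hq : q x = ⟨p, hx ▸ (q x).2⟩ := Subtype.ext hx
    rw [if_pos hx, hq, quotBasis_repr_elt _ _ (hx ▸ (q x).2)]
    ring
  · rw [if_neg hx, quotBasis_repr_elt_of_ne _ _ hx]
    ring

/-- By `hq`, no factor other than the one at `x₀` reads the `p'`-coordinate, the only one that the
shear alters. -/
lemma tBasis_repr_elt {n : ℕ} {S : USet n} [DecidableEq S.carrier] {p p' : Fin n × ℕ}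
    (h : p'.1 ≤ p.1) (u : ⨂[ℂ] x : S.carrier, QuotV n (S.weight x).val) (q : TIdx S)
    (x₀ : S.carrier) (hp : (S.weight x₀).val ≤ p.1.val) (hp' : (S.weight x₀).val ≤ p'.1.val)
    (hq : ∀ x, x ≠ x₀ → (q x).1 ≠ p') :
    (tBasis S).repr (tRep S (elt h) u) (Function.update q x₀ ⟨p', hp'⟩) =
      (tBasis S).repr u (Function.update q x₀ ⟨p', hp'⟩) +
        (tBasis S).repr u (Function.update q x₀ ⟨p, hp⟩) := by
  suffices h : (tBasis S).coord (Function.update q x₀ ⟨p', hp'⟩) ∘ₗ tRep S (elt h) =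
      (tBasis S).coord (Function.update q x₀ ⟨p', hp'⟩) +
        (tBasis S).coord (Function.update q x₀ ⟨p, hp⟩) from LinearMap.congr_fun h u
  have := Fintype.ofFinite S.carrier
  apply PiTensorProduct.ext
  apply MultilinearMap.ext
  intro v
  simp only [LinearMap.compMultilinearMap_apply, LinearMap.comp_apply, tensorRep_tprod,
    Module.Basis.coord_apply, tBasis_repr_tprod, LinearMap.add_apply]
  simp only [← Finset.mul_prod_erase _ _ (Finset.mem_univ x₀), Function.update_self]
  have key (r : TIdx S) (s : {p : Fin n × ℕ // (S.weight x₀).val ≤ p.1.val})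
      (w : ∀ x : S.carrier, QuotV n (S.weight x).val) :
      ∏ x ∈ Finset.univ.erase x₀,
        (quotBasis n (S.weight x).val).repr (w x) (Function.update r x₀ s x) =
      ∏ x ∈ Finset.univ.erase x₀, (quotBasis n (S.weight x).val).repr (w x) (r x) :=
    Finset.prod_congr rfl fun x hx => by
      rw [Function.update_of_ne (Finset.ne_of_mem_erase hx)]
  rw [key, key, key, quotBasis_repr_elt _ _ hp, add_mul]
  congr 2 <;> refine Finset.prod_congr rfl fun x hx => ?_ <;>
    exact quotBasis_repr_elt_of_ne _ _ (hq x (Finset.ne_of_mem_erase hx))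

/-- As `e_p` occurs only at `x₀`, the multilinear expansion has a single new term. -/
lemma tRep_elt_tBasis {n : ℕ} {S : USet n} [DecidableEq S.carrier] {p p' : Fin n × ℕ}
    (h : p'.1 ≤ p.1) (q : TIdx S) (x₀ : S.carrier) (hq₀ : (q x₀).1 = p)
    (hq : ∀ x, x ≠ x₀ → (q x).1 ≠ p) :
    tRep S (elt h) (tBasis S q) = tBasis S q +
      PiTensorProduct.tprod ℂ (Function.update
        (fun x => quotMk n (S.weight x).val (stdE n (q x).1)) x₀
        (quotMk n (S.weight x₀).val (stdE n p'))) := by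
  rw [tBasis_apply, tensorRep_tprod]
  set v := fun x => quotMk n (S.weight x).val (stdE n (q x).1) with hv
  have e : (fun x => quotRep n (S.weight x).val (elt h) (v x)) =
      Function.update v x₀ (v x₀ + quotMk n (S.weight x₀).val (stdE n p')) := by
    funext x
    rw [hv]
    simp only
    rw [quotRep_quotMk, stdRep_elt, Module.Basis.repr_self]
    by_cases hx : x = x₀
    · subst hx
      rw [Function.update_self, hq₀, Finsupp.single_eq_same, one_smul, map_add]
    · rw [Function.update_of_ne hx, Finsupp.single_apply, if_neg (hq x hx), zero_smul, add_zero]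
  rw [e, MultilinearMap.map_update_add, Function.update_eq_self]

/-! ### A cyclic vector of `T_S` -/

/-- Apply `g - 1`, where `g` shears the factor at `x₀` towards the new one; `g` lies in `𝐆` because
`L` is the last block. -/
lemma tBasis_update_mem {n : ℕ} {S : USet n} [DecidableEq S.carrier]
    {W : Submodule ℂ (⨂[ℂ] x : S.carrier, QuotV n (S.weight x).val)}
    (hW : ∀ g, ∀ v ∈ W, tRep S g v ∈ W) {L : Fin n} (hL : ∀ i, i ≤ L) {q : TIdx S}
    (hqW : tBasis S q ∈ W) (x₀ : S.carrier) (hx₀ : (q x₀).1.1 = L)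
    (hq : ∀ x, x ≠ x₀ → (q x).1 ≠ (q x₀).1)
    (r : {p : Fin n × ℕ // (S.weight x₀).val ≤ p.1.val}) :
    tBasis S (Function.update q x₀ r) ∈ W := by
  have h : r.1.1 ≤ (q x₀).1.1 := hx₀ ▸ hL _
  have hg := tRep_elt_tBasis h q x₀ rfl hq
  have e : PiTensorProduct.tprod ℂ (Function.update
        (fun x => quotMk n (S.weight x).val (stdE n (q x).1)) x₀
        (quotMk n (S.weight x₀).val (stdE n r.1))) = tBasis S (Function.update q x₀ r) := by
    rw [tBasis_apply]
    congr 1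
    funext x
    by_cases hx : x = x₀
    · subst hx
      simp
    · simp [Function.update_of_ne hx]
  rw [e] at hg
  have h2 := W.sub_mem (hW (elt h) _ hqW) hqW
  rwa [hg, add_sub_cancel_left] at h2

/-- The index of the monomial `⨂ e_{L, j x}`, for `L` the last block. -/
def topIdx {n : ℕ} (S : USet n) {L : Fin n} (hL : ∀ i, i ≤ L) (j : S.carrier → ℕ) : TIdx S :=
  fun x => ⟨(L, j x), hL (S.weight x)⟩

lemma tBasis_mem_of_disjoint {n : ℕ} {S : USet n}
    {W : Submodule ℂ (⨂[ℂ] x : S.carrier, QuotV n (S.weight x).val)}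
    (hW : ∀ g, ∀ v ∈ W, tRep S g v ∈ W) {L : Fin n} (hL : ∀ i, i ≤ L) {j : S.carrier → ℕ}
    (hj : j.Injective) (hjW : tBasis S (topIdx S hL j) ∈ W) (q : TIdx S)
    (hq : ∀ x x', (q x).1 ≠ (L, j x')) : tBasis S q ∈ W := by
  classical
  have := Fintype.ofFinite S.carrier
  -- The factors in `A` have already been replaced; disjointness from the `(L, j x')` keeps the
  -- vector to be moved next from occurring twice.
  suffices h : ∀ A : Finset S.carrier, tBasis S (A.piecewise q (topIdx S hL j)) ∈ W by
    simpa using h Finset.univ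
  intro A
  induction A using Finset.induction_on with
  | empty => simpa using hjW
  | insert x₀ A hx₀ ih =>
    rw [Finset.piecewise_insert]
    have h₀ : A.piecewise q (topIdx S hL j) x₀ = topIdx S hL j x₀ :=
      Finset.piecewise_eq_of_notMem _ _ _ hx₀
    refine tBasis_update_mem hW hL ih x₀ (by rw [h₀]; rfl) (fun x hx => ?_) _
    rw [h₀]
    by_cases hxA : x ∈ A
    · rw [Finset.piecewise_eq_of_mem _ _ _ hxA]
      exact hq x x₀
    · rw [Finset.piecewise_eq_of_notMem _ _ _ hxA]
      exact fun hc => hx (hj (congrArg Prod.snd hc))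

lemma eq_top_of_tBasis_topIdx_mem {n : ℕ} {S : USet n}
    {W : Submodule ℂ (⨂[ℂ] x : S.carrier, QuotV n (S.weight x).val)}
    (hW : ∀ g, ∀ v ∈ W, tRep S g v ∈ W) {L : Fin n} (hL : ∀ i, i ≤ L) {j : S.carrier → ℕ}
    (hj : j.Injective) (hjW : tBasis S (topIdx S hL j) ∈ W) : W = ⊤ := by
  have := Fintype.ofFinite S.carrier
  rw [eq_top_iff, ← (tBasis S).span_eq, Submodule.span_le]
  rintro _ ⟨q, rfl⟩
  -- `M` exceeds every second index in `j` and in `q`, so the monomial of `M + j` shares no basis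
  -- vector with either.
  let M := ∑ x, (j x + (q x).1.2) + 1
  have hM (x) : j x + (q x).1.2 < M :=
    Nat.lt_succ_of_le (Finset.single_le_sum (f := fun x => j x + (q x).1.2)
      (fun _ _ => Nat.zero_le _) (Finset.mem_univ x))
  have hj' : (fun x => M + j x).Injective := fun x y h => hj (Nat.add_left_cancel h)
  -- Two passes, from `j` to `M + j` and then to `q`, since `q` may share vectors with the monomial
  -- of `j`.
  refine tBasis_mem_of_disjoint hW hL hj' (tBasis_mem_of_disjoint hW hL hj hjW _ ?_) q ?_
  · intro x x' hc
    have h1 : M + j x = j x' := congrArg Prod.snd hc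
    have := hM x'
    omega
  · intro x x' hc
    have h1 : (q x).1.2 = M + j x' := congrArg Prod.snd hc
    have := hM x
    omega

/-- The locus where two equivariant maps agree is a subrepresentation, here containing a cyclic
vector. -/
lemma intertwining_ext {n : ℕ} {S T : USet n} {L : Fin n} (hL : ∀ i, i ≤ L) {j : S.carrier → ℕ}
    (hj : j.Injective) {F F' : (tRep S).IntertwiningMap (tRep T)}
    (h : F (tBasis S (topIdx S hL j)) = F' (tBasis S (topIdx S hL j))) : F = F' := by
  apply Representation.IntertwiningMap.toLinearMap_injective
  rw [← LinearMap.eqLocus_eq_top]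
  refine eq_top_of_tBasis_topIdx_mem (fun g v hv => ?_) hL hj h
  change F (tRep S g v) = F' (tRep S g v)
  rw [F.isIntertwining, F'.isIntertwining]
  exact congrArg _ hv

/-! ### The image of the cyclic vector under an equivariant map -/

/-- `F` preserves eigenvectors and eigenvalues of the doubling of `e_p`, and distinct multiplicities
give distinct powers of `2`. -/
lemma card_eq_of_repr_ne_zero {n : ℕ} {S T : USet n} [Fintype S.carrier] [Fintype T.carrier]
    (F : (tRep S).IntertwiningMap (tRep T)) (s : TIdx S) (q : TIdx T)
    (hq : (tBasis T).repr (F (tBasis S s)) q ≠ 0) (p : Fin n × ℕ) :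
    (Finset.univ.filter fun y => (q y).1 = p).card =
      (Finset.univ.filter fun x => (s x).1 = p).card := by
  have h1 : tRep S (elt (le_refl p.1)) (tBasis S s) =
      (2 ^ (Finset.univ.filter fun x => (s x).1 = p).card : ℂ) • tBasis S s := by
    apply (tBasis S).repr.injective
    ext r
    rw [tBasis_repr_elt_self, map_smul, Finsupp.smul_apply, smul_eq_mul, Module.Basis.repr_self,
      Finsupp.single_apply]
    split_ifs with h
    · rw [h]
    · simp
  have h2 := tBasis_repr_elt_self p (F (tBasis S s)) q
  rw [← F.isIntertwining, h1, map_smul, map_smul, Finsupp.smul_apply, smul_eq_mul] at h2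
  have h3 := mul_right_cancel₀ hq h2
  have h4 : (2 : ℕ) ^ (Finset.univ.filter fun x => (s x).1 = p).card =
    2 ^ (Finset.univ.filter fun y => (q y).1 = p).card := by exact_mod_cast h3
  exact (Nat.pow_right_injective le_rfl h4).symm

lemma exists_equiv_of_repr_ne_zero {n : ℕ} {S T : USet n}
    (F : (tRep S).IntertwiningMap (tRep T)) {s : TIdx S}
    (hs : (fun x => (s x).1).Injective) {q : TIdx T}
    (hq : (tBasis T).repr (F (tBasis S s)) q ≠ 0) :
    ∃ e : S.carrier ≃ T.carrier, ∀ x, (q (e x)).1 = (s x).1 := by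
  classical
  have := Fintype.ofFinite S.carrier
  have := Fintype.ofFinite T.carrier
  have hc := card_eq_of_repr_ne_zero F s q hq
  have hs1 (x : S.carrier) : (Finset.univ.filter fun x' => (s x').1 = (s x).1) = {x} := by
    ext x'
    simpa using ⟨fun h => hs h, fun h => by rw [h]⟩
  have h1 (x : S.carrier) : ∃ y, Finset.univ.filter (fun y => (q y).1 = (s x).1) = {y} := by
    rw [← Finset.card_eq_one, hc, hs1, Finset.card_singleton]
  choose f hf using h1
  have hf' (x y) : (q y).1 = (s x).1 ↔ y = f x := by
    have := Finset.ext_iff.mp (hf x) y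
    simpa using this
  refine ⟨Equiv.ofBijective f ⟨fun x x' h => ?_, fun y => ?_⟩, fun x => (hf' x _).mpr rfl⟩
  · exact hs (((hf' x (f x)).mpr rfl).symm.trans ((hf' x' (f x)).mpr h))
  -- Surjectivity: the basis vector at `y` occurs in `q`, hence equally often in `s`.
  · have h2 : 0 < (Finset.univ.filter fun x => (s x).1 = (q y).1).card := by
      rw [← hc, Finset.card_pos]
      exact ⟨y, by simp⟩
    obtain ⟨x, hx⟩ := Finset.card_pos.mp h2
    exact ⟨x, ((hf' x y).mp (Finset.mem_filter.mp hx).2.symm).symm⟩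

/-- If the weight dropped, shearing `e_{L, j x₀}` towards a vector of block `T.weight (e x₀)` would
fix the source monomial, as that vector dies in the factor at `x₀`. In the target factor it
survives, and invariance forces the coefficient at `q` to vanish. -/
lemma weight_le_of_repr_ne_zero {n : ℕ} {S T : USet n} {L : Fin n} (hL : ∀ i, i ≤ L)
    {j : S.carrier → ℕ} (hj : j.Injective) (F : (tRep S).IntertwiningMap (tRep T)) {q : TIdx T}
    (hq : (tBasis T).repr (F (tBasis S (topIdx S hL j))) q ≠ 0) (e : S.carrier ≃ T.carrier)
    (he : ∀ x, (q (e x)).1 = (L, j x)) (x₀ : S.carrier) : S.weight x₀ ≤ T.weight (e x₀) := by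
  classical
  by_contra! hlt
  have hlt' : T.weight (e x₀) < L := hlt.trans_le (hL _)
  -- The second index `0` is arbitrary; only the block matters.
  have h : ((T.weight (e x₀), 0) : Fin n × ℕ).1 ≤ ((L, j x₀) : Fin n × ℕ).1 := hlt'.le
  have h1 := tRep_elt_tBasis h (topIdx S hL j) x₀ rfl
    fun x hx hc => hx (hj (congrArg Prod.snd hc))
  have h0 : quotMk n (S.weight x₀).val (stdE n (T.weight (e x₀), 0)) = 0 :=
    quotMk_eq_zero.mpr (Submodule.subset_span ⟨_, hlt, rfl⟩)
  rw [h0, MultilinearMap.map_update_zero, add_zero] at h1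
  -- All factors of `q` lie in block `L`, strictly above the new vector, so that vector does not
  -- occur in `q`.
  have h2 := tBasis_repr_elt h (F (tBasis S (topIdx S hL j))) q (e x₀) (hL _) le_rfl (by
    intro y hy hc
    rw [← e.apply_symm_apply y, he] at hc
    exact hlt'.ne' (congrArg Prod.fst hc))
  rw [← F.isIntertwining, h1, left_eq_add] at h2
  refine hq (Eq.trans ?_ h2)
  congr 1
  rw [eq_comm, Function.update_eq_self_iff]
  exact Subtype.ext (he x₀).symm

/-- The map `T_S → T_T` attached to a morphism of `𝒰`, unbundled. -/
abbrev tMap {n : ℕ} {S T : USet n} (f : S ⟶ T) : (tRep S).IntertwiningMap (tRep T) :=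
  transport (proj n) (w := fun x => (S.weight x).val) (w' := fun y => (T.weight y).val)
    f.toEquiv (weight_symm_le f)

lemma tMap_tBasis_topIdx {n : ℕ} {S T : USet n} {L : Fin n} (hL : ∀ i, i ≤ L)
    (j : S.carrier → ℕ) (f : S ⟶ T) :
    tMap f (tBasis S (topIdx S hL j)) = tBasis T (topIdx T hL (j ∘ f.toEquiv.symm)) := by
  rw [tBasis_apply, tBasis_apply]
  exact transport_tprod _ _ _ _

lemma topIdx_comp_injective {n : ℕ} {S T : USet n} {L : Fin n} (hL : ∀ i, i ≤ L)
    {j : S.carrier → ℕ} (hj : j.Injective) :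
    Function.Injective fun f : S ⟶ T => topIdx T hL (j ∘ f.toEquiv.symm) := by
  intro f g h
  apply UHom.ext
  rw [← f.toEquiv.symm_symm, ← g.toEquiv.symm_symm]
  congr 1
  ext y
  exact hj (congrArg (fun q : TIdx T => (q y).1.2) h)

/-- The images are distinct basis monomials: since `j` is injective, each determines its `f`. -/
lemma linearIndependent_tMap_tBasis {n : ℕ} {S : USet n} (T : USet n) {L : Fin n}
    (hL : ∀ i, i ≤ L) {j : S.carrier → ℕ} (hj : j.Injective) :
    LinearIndependent ℂ fun f : S ⟶ T => tMap f (tBasis S (topIdx S hL j)) := by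
  simp only [tMap_tBasis_topIdx]
  exact (tBasis T).linearIndependent.comp _ (topIdx_comp_injective hL hj)

lemma intertwining_apply_mem_span {n : ℕ} {S T : USet n} {L : Fin n}
    (hL : ∀ i, i ≤ L) {j : S.carrier → ℕ} (hj : j.Injective)
    (F : (tRep S).IntertwiningMap (tRep T)) :
    F (tBasis S (topIdx S hL j)) ∈
      Submodule.span ℂ (Set.range fun f : S ⟶ T => tMap f (tBasis S (topIdx S hL j))) := by
  rw [← (tBasis T).linearCombination_repr (F (tBasis S (topIdx S hL j)))]
  refine Submodule.sum_mem _ fun q hq => Submodule.smul_mem _ _ (Submodule.subset_span ?_)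
  have hq := Finsupp.mem_support_iff.mp hq
  obtain ⟨e, he⟩ := exists_equiv_of_repr_ne_zero F
    (fun x y h => hj (congrArg Prod.snd h)) hq
  refine ⟨⟨e, weight_le_of_repr_ne_zero hL hj F hq e he⟩, ?_⟩
  simp only [tMap_tBasis_topIdx]
  congr 1
  funext y
  apply Subtype.ext
  rw [← e.apply_symm_apply y, he]
  simp [topIdx]

/-! ### `Hom_𝐆(T_S, T_T)` is spanned freely by `Hom_𝒰(S, T)` -/

/-- The linear map `ℂ[Hom_𝒰(S, T)] → Hom_𝐆(T_S, T_T)` extending the functor `𝒯`. -/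
def homMap {n : ℕ} (S T : USet n) :
    ((S ⟶ T) →₀ ℂ) →ₗ[ℂ] ((TFunctor n).obj S ⟶ (TFunctor n).obj T) :=
  Finsupp.linearCombination ℂ fun f => (TFunctor n).map f

lemma homMap_single {n : ℕ} {S T : USet n} (f : S ⟶ T) :
    homMap S T (Finsupp.single f 1) = (TFunctor n).map f := by
  rw [homMap, Finsupp.linearCombination_single, one_smul]

/-- Evaluation of a homomorphism at a vector. -/
def evalAt {n : ℕ} {A B : Rep.{0} ℂ (Gpar n)} (v : A) : (A ⟶ B) →ₗ[ℂ] B where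
  toFun F := F.hom v
  map_add' _ _ := rfl
  map_smul' _ _ := rfl

lemma evalAt_homMap {n : ℕ} {S T : USet n} (v : (TFunctor n).obj S) (c : (S ⟶ T) →₀ ℂ) :
    (homMap S T c).hom v =
      Finsupp.linearCombination ℂ (fun f => ((TFunctor n).map f).hom v) c :=
  (Finsupp.apply_linearCombination ℂ (evalAt (B := (TFunctor n).obj T) v) _ c)

/-- Both halves are tested on one cyclic vector: independence of its images gives injectivity, and
the span statement with `intertwining_ext` gives surjectivity. -/
lemma homMap_bijective {n : ℕ} (S T : USet n) {L : Fin n} (hL : ∀ i, i ≤ L) :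
    Function.Bijective (homMap S T) := by
  obtain ⟨m, ⟨e⟩⟩ := Finite.exists_equiv_fin S.carrier
  have hj : Function.Injective fun x => (e x : ℕ) := Fin.val_injective.comp e.injective
  constructor
  · intro c c' h
    refine linearIndependent_tMap_tBasis T hL hj ?_
    have h1 := congrArg (fun F => F.hom (tBasis S (topIdx S hL fun x => (e x : ℕ)) : (TFunctor n).obj S)) h
    exact (evalAt_homMap _ c).symm.trans (h1.trans (evalAt_homMap _ c'))
  · intro F
    obtain ⟨c, hc⟩ := Finsupp.mem_span_range_iff_exists_finsupp.mp
      (intertwining_apply_mem_span hL hj F.hom)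
    refine ⟨c, Rep.hom_ext (intertwining_ext hL hj ?_)⟩
    exact (evalAt_homMap _ c).trans hc

/-- The isomorphism `ℂ[Hom_𝒰(S, T)] ≃ Hom_𝐆(T_S, T_T)`. -/
def homEquiv {n : ℕ} (S T : USet n) {L : Fin n} (hL : ∀ i, i ≤ L) :
    ((S ⟶ T) →₀ ℂ) ≃ₗ[ℂ] ((TFunctor n).obj S ⟶ (TFunctor n).obj T) :=
  LinearEquiv.ofBijective (homMap S T) (homMap_bijective S T hL)

/-- The isomorphism `P_S ≅ Hom_𝐆(T_S, -)`. -/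
def princProjIso {n : ℕ} (S : USet n) {L : Fin n} (hL : ∀ i, i ≤ L) : princProj S ≅ homT S :=
  NatIso.ofComponents (fun T => (homEquiv S T hL).toModuleIso) (by
    intro T T' f
    ext : 1
    apply Finsupp.lhom_ext'
    intro φ
    apply LinearMap.ext_ring
    change homMap S T' (Finsupp.mapDomain (fun φ => φ ≫ f) (Finsupp.single φ 1)) =
      homMap S T (Finsupp.single φ 1) ≫ (TFunctor n).map f
    rw [Finsupp.mapDomain_single, homMap_single, homMap_single, Functor.map_comp])

/-! ### Finiteness, non-vanishing and dimension of the Hom spaces -/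

instance {n : ℕ} (S T : USet n) : Finite (S ⟶ T) :=
  Finite.of_injective (fun f : S ⟶ T => f.toEquiv) fun _ _ h => UHom.ext h

instance {n : ℕ} (S T : DSet n) : Finite (S ⟶ T) :=
  Finite.of_injective (fun f : S ⟶ T => f.toEquiv) fun _ _ h => DHom.ext h

lemma nontrivial_hom_iff {n : ℕ} (S T : USet n) {L : Fin n} (hL : ∀ i, i ≤ L) :
    Nontrivial ((TFunctor n).obj S ⟶ (TFunctor n).obj T) ↔ Nonempty (S ⟶ T) := by
  rw [← (homEquiv S T hL).toEquiv.nontrivial_congr]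
  constructor
  · intro h
    by_contra hc
    rw [not_nonempty_iff] at hc
    exact not_subsingleton _ (inferInstance : Subsingleton ((S ⟶ T) →₀ ℂ))
  · intro h
    infer_instance

lemma finrank_hom {n : ℕ} (S T : USet n) {L : Fin n} (hL : ∀ i, i ≤ L) :
    Module.finrank ℂ ((TFunctor n).obj S ⟶ (TFunctor n).obj T) = Nat.card (S ⟶ T) := by
  have := Fintype.ofFinite (S ⟶ T)
  rw [← (homEquiv S T hL).finrank_eq, Module.finrank_finsupp_self, Nat.card_eq_fintype_card]

/-- An isomorphism of `𝒰` from a bijection preserving weights. -/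
def USet.isoOfEquiv {n : ℕ} {S T : USet n} (e : S.carrier ≃ T.carrier)
    (h : ∀ x, S.weight x = T.weight (e x)) : S ≅ T where
  hom := ⟨e, fun x => (h x).le⟩
  inv := ⟨e.symm, fun y => by rw [h, e.apply_symm_apply]⟩
  hom_inv_id := UHom.ext e.self_trans_symm
  inv_hom_id := UHom.ext e.symm_trans_self

/-- A nonzero value at `T` yields a bijection `S → T`, so `T` is the carrier of `S` with one of
finitely many weight functions. -/
lemma isFiniteModule_homT {n : ℕ} (S : USet n) {L : Fin n} (hL : ∀ i, i ≤ L) :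
    IsFiniteModule (homT S) where
  finite_obj T := Module.Finite.equiv (homEquiv S T hL)
  finite_support := by
    refine ⟨Set.range fun w : S.carrier → Fin n => { carrier := S.carrier, weight := w },
      Set.finite_range _, fun T hT => ?_⟩
    obtain ⟨f⟩ := (nontrivial_hom_iff S T hL).mp hT
    let S' : USet n := { carrier := S.carrier, weight := fun x => T.weight (f.toEquiv x) }
    exact ⟨S', ⟨_, rfl⟩, ⟨(USet.isoOfEquiv (S := S') f.toEquiv fun _ => rfl).symm⟩⟩

/-! ### `P_S` is the dual of `J_S` -/

/-- Inversion is a bijection `Hom_𝒰(S, T) ≃ Hom_𝒟(T, S)`. -/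
def invEquiv {n : ℕ} (S T : USet n) : (S ⟶ T) ≃ (T.toD ⟶ S.toD) where
  toFun := UHom.inv
  invFun g := ⟨g.toEquiv.symm, fun x =>
    (congrArg S.weight (g.toEquiv.apply_symm_apply x)).symm.le.trans
      (g.weight_le (g.toEquiv.symm x))⟩
  left_inv _ := rfl
  right_inv _ := rfl

/-- The isomorphism `P_S ≅ (J_S)^∨`. -/
def princProjIsoDual {n : ℕ} (S : USet n) : princProj S ≅ dualOfD (princInj S.toD) :=
  -- Hom sets are finite, so evaluation into the double dual is an isomorphism.
  NatIso.ofComponents (fun T => ((Finsupp.domLCongr (invEquiv S T)).trans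
    (Module.evalEquiv ℂ ((T.toD ⟶ S.toD) →₀ ℂ))).toModuleIso) (by
    intro T T' f
    ext : 1
    apply Finsupp.lhom_ext'
    intro φ
    apply LinearMap.ext_ring
    change Module.Dual.eval ℂ ((T'.toD ⟶ S.toD) →₀ ℂ) (Finsupp.domLCongr (invEquiv S T')
        (Finsupp.mapDomain (fun φ => φ ≫ f) (Finsupp.single φ 1))) =
      (Finsupp.lmapDomain ℂ ℂ (fun ψ => UHom.inv f ≫ ψ)).dualMap.dualMap
        (Module.Dual.eval ℂ ((T.toD ⟶ S.toD) →₀ ℂ)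
          (Finsupp.domLCongr (invEquiv S T) (Finsupp.single φ 1)))
    rw [Finsupp.mapDomain_single, Finsupp.domLCongr_single, Finsupp.domLCongr_single]
    apply LinearMap.ext
    intro ξ
    change ξ _ = ξ (Finsupp.mapDomain _ _)
    rw [Finsupp.mapDomain_single]
    rfl)

lemma princProjIsoDual_hom_app_single {n : ℕ} {S T : USet n} (φ : S ⟶ T) :
    ((princProjIsoDual S).hom.app T).hom (Finsupp.single φ 1) =
      Module.Dual.eval ℂ ((T.toD ⟶ S.toD) →₀ ℂ) (Finsupp.single (UHom.inv φ) 1) := by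
  change Module.Dual.eval ℂ ((T.toD ⟶ S.toD) →₀ ℂ)
    (Finsupp.domLCongr (invEquiv S T) (Finsupp.single φ 1)) = _
  rw [Finsupp.domLCongr_single]
  rfl

/-! ### Counting the morphisms of `𝒰` -/

/-- The function on `⨆_{i ≤ n} [bᵢ]` with given restrictions to the last block and to the others. -/
def glue {X : Type*} {n : ℕ} {b : Fin (n + 1) → ℕ} (f : (Σ i : Fin n, Fin (b i.castSucc)) → X)
    (g : Fin (b (Fin.last n)) → X) (y : Σ i : Fin (n + 1), Fin (b i)) : X :=
  Fin.lastCases (motive := fun i => Fin (b i) → X) g (fun i z => f ⟨i, z⟩) y.1 y.2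

lemma glue_last {X : Type*} {n : ℕ} {b : Fin (n + 1) → ℕ}
    (f : (Σ i : Fin n, Fin (b i.castSucc)) → X) (g : Fin (b (Fin.last n)) → X)
    (y : Fin (b (Fin.last n))) : glue f g ⟨Fin.last n, y⟩ = g y := by
  simp [glue]

lemma glue_castSucc {X : Type*} {n : ℕ} {b : Fin (n + 1) → ℕ}
    (f : (Σ i : Fin n, Fin (b i.castSucc)) → X) (g : Fin (b (Fin.last n)) → X) (i : Fin n)
    (y : Fin (b i.castSucc)) : glue f g ⟨i.castSucc, y⟩ = f ⟨i, y⟩ := by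
  simp [glue]

/-- The number of injections of `⨆ᵢ [bᵢ]` into `X` mapping the `i`-th block into `N i`, for an
increasing family of subsets `N i`. -/
lemma card_embedding_of_monotone {X : Type*} [Fintype X] {n : ℕ} (N : Fin n → Finset X)
    (hN : Monotone N) (b : Fin n → ℕ) :
    Nat.card {f : (Σ i : Fin n, Fin (b i)) ↪ X // ∀ y, f y ∈ N y.1} =
      ∏ i, ((N i).card - ∑ j ∈ Finset.Iio i, b j).descFactorial (b i) := by
  classical
  induction n with
  | zero =>
    have : Unique {f : (Σ i : Fin 0, Fin (b i)) ↪ X // ∀ y, f y ∈ N y.1} :=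
      { default := ⟨⟨fun y => y.1.elim0, fun y => y.1.elim0⟩, fun y => y.1.elim0⟩
        uniq := fun f => Subtype.ext (DFunLike.ext _ _ fun y => y.1.elim0) }
    simp
  | succ n ih =>
    have ih := ih (fun i => N i.castSucc) (fun i j h => hN (Fin.castSucc_le_castSucc_iff.mpr h))
      (fun i => b i.castSucc)
    -- An injection is split into its restriction `f` to all blocks but the last and an injection of
    -- the last block avoiding the image of `f`.
    let P := {f : (Σ i : Fin n, Fin (b i.castSucc)) ↪ X // ∀ y, f y ∈ N y.1.castSucc}
    let Q (f : P) := Fin (b (Fin.last n)) ↪ ↥(N (Fin.last n) \ Finset.univ.map f.1)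
    have hext : ∀ f g : Σ f : P, Q f, (∀ y, f.1.1 y = g.1.1 y) →
        (∀ z, (f.2 z).1 = (g.2 z).1) → f = g := by
      rintro ⟨f, f'⟩ ⟨g, g'⟩ h h'
      obtain rfl : f = g := Subtype.ext (DFunLike.ext _ _ h)
      obtain rfl : f' = g' := DFunLike.ext _ _ fun z => Subtype.ext (h' z)
      rfl
    have e : {f : (Σ i : Fin (n + 1), Fin (b i)) ↪ X // ∀ y, f y ∈ N y.1} ≃ Σ f : P, Q f :=
      { toFun := fun f => ⟨⟨⟨fun y => f.1 ⟨y.1.castSucc, y.2⟩, fun y z h => by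
            have h := f.1.injective h
            rcases y with ⟨i, y⟩
            rcases z with ⟨i', z⟩
            simp only [Sigma.mk.injEq, Fin.castSucc_inj] at h
            obtain ⟨rfl, h⟩ := h
            rw [eq_of_heq h]⟩, fun y => f.2 _⟩,
          ⟨fun z => ⟨f.1 ⟨Fin.last n, z⟩, by
            rw [Finset.mem_sdiff]
            refine ⟨f.2 _, fun hc => ?_⟩
            obtain ⟨y, -, hy⟩ := Finset.mem_map.mp hc
            exact (Fin.castSucc_lt_last y.1).ne (congrArg Sigma.fst (f.1.injective hy))⟩,
          fun z z' h => by
            have h := f.1.injective (congrArg Subtype.val h)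
            simpa using h⟩⟩
        invFun := fun f => ⟨⟨glue f.1.1 fun z => (f.2 z).1, by
              rintro ⟨i, y⟩ ⟨i', y'⟩ h
              induction i using Fin.lastCases with
              | last =>
                induction i' using Fin.lastCases with
                | last =>
                  rw [glue_last, glue_last] at h
                  rw [f.2.injective (Subtype.ext h)]
                | cast i' =>
                  rw [glue_last, glue_castSucc] at h
                  exact absurd (Finset.mem_map.mpr ⟨_, Finset.mem_univ _, h.symm⟩)
                    (Finset.mem_sdiff.mp (f.2 y).2).2
              | cast i =>
                induction i' using Fin.lastCases with
                | last =>
                  rw [glue_last, glue_castSucc] at h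
                  exact absurd (Finset.mem_map.mpr ⟨_, Finset.mem_univ _, h⟩)
                    (Finset.mem_sdiff.mp (f.2 y').2).2
                | cast i' =>
                  rw [glue_castSucc, glue_castSucc] at h
                  have h := f.1.1.injective h
                  simp only [Sigma.mk.injEq] at h
                  obtain ⟨rfl, h⟩ := h
                  rw [eq_of_heq h]⟩, by
            rintro ⟨i, y⟩
            induction i using Fin.lastCases with
            | last =>
              change glue f.1.1 (fun z => (f.2 z).1) _ ∈ _
              rw [glue_last]
              exact (Finset.mem_sdiff.mp (f.2 y).2).1
            | cast i =>
              change glue f.1.1 (fun z => (f.2 z).1) _ ∈ _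
              rw [glue_castSucc]
              exact f.1.2 _⟩
        left_inv := fun f => by
          apply Subtype.ext
          apply DFunLike.ext
          rintro ⟨i, y⟩
          induction i using Fin.lastCases with
          | last => exact glue_last _ _ _
          | cast i => exact glue_castSucc _ _ _ _
        right_inv := fun f => hext _ _ (fun y => glue_castSucc _ _ _ _) fun z => glue_last _ _ _ }
    -- As `N` is increasing, the image of `f` lies in `N (Fin.last n)`; the number of choices is
    -- therefore independent of `f`, and the subtraction is not truncated.
    have hQ (f : P) : Nat.card (Q f) =
        ((N (Fin.last n)).card - ∑ j ∈ Finset.Iio (Fin.last n), b j).descFactorial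
          (b (Fin.last n)) := by
      rw [Nat.card_eq_fintype_card, Fintype.card_embedding_eq, Fintype.card_fin,
        Fintype.card_coe, Finset.card_sdiff_of_subset, Finset.card_map, Finset.card_univ,
        Fintype.card_sigma]
      · simp only [Fintype.card_fin]
        rw [Fin.Iio_last_eq_map, Finset.sum_map]
        rfl
      · intro x hx
        obtain ⟨y, -, rfl⟩ := Finset.mem_map.mp hx
        exact hN (Fin.le_last _) (f.2 y)
    rw [Nat.card_congr e, Nat.card_sigma]
    simp only [hQ]
    rw [Finset.sum_const, Finset.card_univ, ← Nat.card_eq_fintype_card, ih, Fin.prod_univ_castSucc,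
      smul_eq_mul]
    congr 1
    refine Finset.prod_congr rfl fun i _ => ?_
    rw [← Fin.map_castSuccEmb_Iio, Finset.sum_map]
    rfl

/-! ### Morphisms between tuples and the dominance order -/

lemma card_filter_fst_le {n : ℕ} (a : Fin n → ℕ) (i : Fin n) :
    (Finset.univ.filter fun x : Σ i : Fin n, Fin (a i) => x.1 ≤ i).card =
      ∑ j ∈ Finset.Iic i, a j := by
  have h : (Finset.univ.filter fun x : Σ i : Fin n, Fin (a i) => x.1 ≤ i) =
      (Finset.Iic i).sigma fun _ => Finset.univ := by
    ext x
    simp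
  rw [h, Finset.card_sigma]
  simp

lemma sum_eq_of_hom {n : ℕ} {a b : Fin n → ℕ} (f : USet.ofTuple a ⟶ USet.ofTuple b) :
    ∑ i, a i = ∑ i, b i := by
  have e : (Σ i : Fin n, Fin (a i)) ≃ (Σ i : Fin n, Fin (b i)) := f.toEquiv
  simpa using Fintype.card_congr e

/-- The inverse bijection embeds the elements of `b` of weight at most `i` into those of `a`. -/
lemma dominates_of_hom {n : ℕ} {a b : Fin n → ℕ} (f : USet.ofTuple a ⟶ USet.ofTuple b) :
    Dominates a b := by
  intro i
  let e : (Σ i : Fin n, Fin (a i)) ≃ (Σ i : Fin n, Fin (b i)) := f.toEquiv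
  rw [← card_filter_fst_le, ← card_filter_fst_le]
  refine Finset.card_le_card_of_injOn e.symm (fun y hy => ?_) e.symm.injective.injOn
  simp only [Finset.coe_filter, Finset.mem_univ, true_and, Set.mem_ofPred_eq] at hy ⊢
  exact le_trans (weight_symm_le f y) hy

/-- The morphism of `𝒰` whose inverse is a given bijection that does not increase weights. -/
def homOfSymm {n : ℕ} {a b : Fin n → ℕ} (e : (Σ i : Fin n, Fin (b i)) ≃ (Σ i : Fin n, Fin (a i)))
    (h : ∀ y, (e y).1 ≤ y.1) : USet.ofTuple a ⟶ USet.ofTuple b where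
  toEquiv := e.symm
  weight_le x := (congrArg Sigma.fst (e.apply_symm_apply x)).symm.le.trans (h (e.symm x))

/-- Morphisms `a → b` of `𝒰` between tuples of the same size are the injections `b → a` that do
not increase weights. -/
def homEquivEmbedding {n : ℕ} {a b : Fin n → ℕ} (h : ∑ i, a i = ∑ i, b i) :
    (USet.ofTuple a ⟶ USet.ofTuple b) ≃
      {f : (Σ i : Fin n, Fin (b i)) ↪ (Σ i : Fin n, Fin (a i)) //
        ∀ y, f y ∈ Finset.univ.filter fun x : Σ i : Fin n, Fin (a i) => x.1 ≤ y.1} where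
  toFun f := ⟨f.toEquiv.symm.toEmbedding, fun y =>
    Finset.mem_filter.mpr ⟨Finset.mem_univ _, weight_symm_le f y⟩⟩
  invFun f := homOfSymm (Equiv.ofBijective f.1
      ((Fintype.bijective_iff_injective_and_card f.1).mpr ⟨f.1.injective, by simp [h]⟩))
    fun y => (Finset.mem_filter.mp (f.2 y)).2
  left_inv f := by
    apply UHom.ext
    apply Equiv.symm_bijective.injective
    ext y : 1
    rfl
  right_inv f := by
    apply Subtype.ext
    ext y : 1
    rfl

lemma card_hom {n : ℕ} {a b : Fin n → ℕ} (h : ∑ i, a i = ∑ i, b i) :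
    Nat.card (USet.ofTuple a ⟶ USet.ofTuple b) =
      ∏ i, ((∑ j ∈ Finset.Iic i, a j) - ∑ j ∈ Finset.Iio i, b j).descFactorial (b i) := by
  rw [Nat.card_congr (homEquivEmbedding h), card_embedding_of_monotone
    (fun i => Finset.univ.filter fun x : Σ i : Fin n, Fin (a i) => x.1 ≤ i)
    (fun i j hij x hx => by
      rw [Finset.mem_filter] at hx ⊢
      exact ⟨hx.1, hx.2.trans hij⟩)]
  simp only [card_filter_fst_le]

lemma sum_Iic_eq {n : ℕ} (b : Fin n → ℕ) (i : Fin n) :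
    ∑ j ∈ Finset.Iic i, b j = ∑ j ∈ Finset.Iio i, b j + b i := by
  rw [← Finset.Iio_insert, Finset.sum_insert (by simp), add_comm]

/-- Existence comes from the count: dominance makes every falling factorial positive. -/
lemma nonempty_hom_iff {n : ℕ} (a b : Fin n → ℕ) :
    Nonempty (USet.ofTuple a ⟶ USet.ofTuple b) ↔ ∑ i, a i = ∑ i, b i ∧ Dominates a b := by
  refine ⟨fun ⟨f⟩ => ⟨sum_eq_of_hom f, dominates_of_hom f⟩, fun ⟨h, hab⟩ => ?_⟩
  refine (Nat.card_pos_iff.mp ?_).1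
  rw [card_hom h]
  refine Finset.prod_pos fun i _ => Nat.descFactorial_pos.mpr ?_
  have := hab i
  rw [sum_Iic_eq b] at this
  omega

lemma card_hom_eq_choose {n : ℕ} {a b : Fin n → ℕ} (h : ∑ i, a i = ∑ i, b i) :
    Nat.card (USet.ofTuple a ⟶ USet.ofTuple b) = (∏ i, (b i).factorial) *
      ∏ i : Fin n with i.val + 1 < n,
        ((∑ j ∈ Finset.Iic i, a j) - ∑ j ∈ Finset.Iio i, b j).choose (b i) := by
  rw [card_hom h, Finset.prod_filter, ← Finset.prod_mul_distrib]
  refine Finset.prod_congr rfl fun i _ => ?_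
  rw [Nat.descFactorial_eq_factorial_mul_choose]
  split_ifs with hi
  · rfl
  -- For the last index the totals agree, so the binomial coefficient is `(b i).choose (b i) = 1`;
  -- this is why the product omits it.
  · have hu : Finset.Iic i = Finset.univ := by
      ext j
      simp only [Finset.mem_Iic, Finset.mem_univ, iff_true, Fin.le_def]
      omega
    have hb := sum_Iic_eq b i
    rw [hu] at hb
    rw [hu, h, hb, Nat.add_sub_cancel_left, Nat.choose_self]

/-! ### The kernel `K_S` -/

/-- The quotient map `𝐕_{m+1} → 𝐕_{m+1} / 𝐕_m`. -/
def grMk (n m : ℕ) : flag n (m + 1) →ₗ[ℂ] GrV n m :=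
  ((flag n m).comap (flag n (m + 1)).subtype).mkQ

lemma grMk_surjective (n m : ℕ) : Function.Surjective (grMk n m) :=
  Submodule.mkQ_surjective _

lemma grIncl_grMk {n m : ℕ} (v : flag n (m + 1)) :
    (grIncl n m).toLinearMap (grMk n m v) = quotMk n m v := rfl

lemma grIncl_injective (n m : ℕ) : Function.Injective (grIncl n m).toLinearMap := by
  rw [injective_iff_map_eq_zero]
  intro v hv
  obtain ⟨v, rfl⟩ := grMk_surjective n m v
  rw [grIncl_grMk, quotMk_eq_zero] at hv
  exact (Submodule.Quotient.mk_eq_zero _).mpr hv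

lemma proj_grIncl {n l m : ℕ} (h : l < m) (h' : l ≤ m) (v : GrV n l) :
    (proj n l m h').toLinearMap ((grIncl n l).toLinearMap v) = 0 := by
  obtain ⟨v, rfl⟩ := grMk_surjective n l v
  rw [grIncl_grMk, proj_quotMk, quotMk_eq_zero]
  exact flag_mono n h v.2

/-- The map `⨂ 𝐕_{(i)} → T_S`, unbundled. -/
abbrev grTensor {n : ℕ} (S : USet n) :
    (tensorRep fun x : S.carrier => grRep n (S.weight x).val).IntertwiningMap (tRep S) :=
  tensorMap fun x : S.carrier => grIncl n (S.weight x).val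

lemma grTensor_tprod {n : ℕ} (S : USet n) (v : ∀ x : S.carrier, GrV n (S.weight x).val) :
    (grTensor S).toLinearMap (PiTensorProduct.tprod ℂ v) =
      PiTensorProduct.tprod ℂ fun x => (grIncl n (S.weight x).val).toLinearMap (v x) :=
  PiTensorProduct.map_tprod _ _

/-- Over a field each inclusion has a linear left inverse, and these tensor to one for the product;
equivariance of the inverses is not needed. -/
lemma grTensor_injective {n : ℕ} (S : USet n) : Function.Injective (grTensor S).toLinearMap := by
  choose r hr using fun x : S.carrier => LinearMap.exists_leftInverse_of_injective
    (grIncl n (S.weight x).val).toLinearMap (LinearMap.ker_eq_bot.mpr (grIncl_injective _ _))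
  have h : PiTensorProduct.map r ∘ₗ (grTensor S).toLinearMap = LinearMap.id := by
    apply PiTensorProduct.ext
    apply MultilinearMap.ext
    intro v
    simp only [LinearMap.compMultilinearMap_apply, LinearMap.comp_apply, grTensor_tprod,
      PiTensorProduct.map_tprod, LinearMap.id_apply]
    congr 1
    funext x
    exact LinearMap.congr_fun (hr x) (v x)
  exact Function.LeftInverse.injective (LinearMap.congr_fun h)

lemma exists_weight_lt_of_not_isIso {n : ℕ} {S T : USet n} (f : S ⟶ T) (hf : ¬ IsIso f) :
    ∃ x, S.weight x < T.weight (f.toEquiv x) := by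
  by_contra! hc
  exact hf (USet.isoOfEquiv f.toEquiv fun x => le_antisymm (f.weight_le x) (hc x)).isIso_hom

lemma not_isIso_of_weight_lt {n : ℕ} {S T : USet n} (f : S ⟶ T) {x : S.carrier}
    (hx : S.weight x < T.weight (f.toEquiv x)) : ¬ IsIso f := by
  intro h
  have h1 : (inv f).toEquiv (f.toEquiv x) = x :=
    congrArg (fun g : S ⟶ S => g.toEquiv x) (IsIso.hom_inv_id f)
  have h2 := (inv f).weight_le (f.toEquiv x)
  rw [h1] at h2
  exact h2.not_gt hx

lemma tMap_tprod {n : ℕ} {S T : USet n} (f : S ⟶ T)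
    (v : ∀ x : S.carrier, QuotV n (S.weight x).val) :
    (tMap f).toLinearMap (PiTensorProduct.tprod ℂ v) = PiTensorProduct.tprod ℂ fun y =>
      (proj n _ _ (weight_symm_le f y)).toLinearMap (v (f.toEquiv.symm y)) :=
  transport_tprod _ _ _ _

/-- A non-isomorphism strictly raises the weight of some `x`, and the projection there kills
`𝐕_{(i)}`. -/
lemma tMap_grTensor_tprod {n : ℕ} {S T : USet n} (f : S ⟶ T) (hf : ¬ IsIso f)
    (v : ∀ x : S.carrier, GrV n (S.weight x).val) :
    (tMap f).toLinearMap ((grTensor S).toLinearMap (PiTensorProduct.tprod ℂ v)) = 0 := by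
  obtain ⟨x, hx⟩ := exists_weight_lt_of_not_isIso f hf
  obtain ⟨y, rfl⟩ := f.toEquiv.symm.surjective x
  rw [Equiv.apply_symm_apply] at hx
  rw [grTensor_tprod, tMap_tprod]
  exact MultilinearMap.map_coord_zero _ y (proj_grIncl hx (weight_symm_le f y) _)

lemma tMap_grTensor {n : ℕ} {S T : USet n} (f : S ⟶ T) (hf : ¬ IsIso f) :
    (tMap f).toLinearMap ∘ₗ (grTensor S).toLinearMap = 0 := by
  apply PiTensorProduct.ext
  apply MultilinearMap.ext
  intro v
  rw [LinearMap.compMultilinearMap_apply, LinearMap.compMultilinearMap_apply,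
    LinearMap.comp_apply, LinearMap.zero_apply]
  exact tMap_grTensor_tprod f hf v

lemma mem_KSub_iff {n : ℕ} {S : USet n} (v : (TFunctor n).obj S) :
    v ∈ KSub S ↔ ∀ (T : USet n) (f : S ⟶ T), ¬ IsIso f → (tMap f).toLinearMap v = 0 := by
  rw [KSub]
  simp only [Submodule.mem_iInf, LinearMap.mem_ker]
  rfl

/-- The projections only discard coordinates, so a monomial that survives keeps its coefficient. -/
lemma tBasis_repr_tMap {n : ℕ} {S T : USet n} (f : S ⟶ T)
    (v : ⨂[ℂ] x : S.carrier, QuotV n (S.weight x).val) (q : TIdx T) (r : TIdx S)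
    (hr : ∀ y, (r (f.toEquiv.symm y)).1 = (q y).1) :
    (tBasis T).repr ((tMap f).toLinearMap v) q = (tBasis S).repr v r := by
  have := Fintype.ofFinite S.carrier
  have := Fintype.ofFinite T.carrier
  suffices h : (tBasis T).coord q ∘ₗ (tMap f).toLinearMap = (tBasis S).coord r from
    LinearMap.congr_fun h v
  apply PiTensorProduct.ext
  apply MultilinearMap.ext
  intro v
  simp only [LinearMap.compMultilinearMap_apply, LinearMap.comp_apply, Module.Basis.coord_apply]
  rw [tMap_tprod, tBasis_repr_tprod, tBasis_repr_tprod, ← Equiv.prod_comp f.toEquiv.symm]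
  refine Finset.prod_congr rfl fun y _ => ?_
  rw [quotBasis_repr_proj]
  congr 1
  exact Subtype.ext (hr y).symm

lemma weight_eq_of_mem_KSub {n : ℕ} {S : USet n}
    {v : ⨂[ℂ] x : S.carrier, QuotV n (S.weight x).val}
    (hv : ∀ (T : USet n) (f : S ⟶ T), ¬ IsIso f → (tMap f).toLinearMap v = 0) {q : TIdx S}
    (hq : (tBasis S).repr v q ≠ 0) (x : S.carrier) : (q x).1.1 = S.weight x := by
  by_contra hne
  have hlt : S.weight x < (q x).1.1 := lt_of_le_of_ne (q x).2 (Ne.symm hne)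
  -- The weights are raised exactly to the blocks of `q`: the monomial survives in `T_T`, and the
  -- map is not invertible because some weight strictly grows.
  let T : USet n := { carrier := S.carrier, weight := fun x => (q x).1.1 }
  let f : S ⟶ T := ⟨Equiv.refl _, fun x => (q x).2⟩
  have h := tBasis_repr_tMap f v (fun x => ⟨(q x).1, le_rfl⟩) q fun _ => rfl
  rw [hv T f (not_isIso_of_weight_lt f hlt), map_zero] at h
  exact hq h.symm

lemma tBasis_mem_range_grTensor {n : ℕ} {S : USet n} {q : TIdx S}
    (hq : ∀ x, (q x).1.1 = S.weight x) :
    tBasis S q ∈ LinearMap.range (grTensor S).toLinearMap := by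
  refine ⟨PiTensorProduct.tprod ℂ fun x => grMk n (S.weight x).val ⟨stdE n (q x).1,
    Submodule.subset_span ⟨_, ?_, rfl⟩⟩, ?_⟩
  · change (q x).1.1.val < _
    rw [hq]
    exact Nat.lt_succ_self _
  · rw [grTensor_tprod, tBasis_apply]
    rfl

lemma range_grTensor {n : ℕ} (S : USet n) :
    LinearMap.range (grTensor S).toLinearMap = KSub S := by
  ext v
  constructor
  · rintro ⟨v, rfl⟩
    exact (mem_KSub_iff _).mpr fun T f hf => LinearMap.congr_fun (tMap_grTensor f hf) v
  · intro hv
    have hv' := (mem_KSub_iff v).mp hv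
    rw [← (tBasis S).linearCombination_repr v]
    exact Submodule.sum_mem _ fun q hq => Submodule.smul_mem _ _ (tBasis_mem_range_grTensor
      (weight_eq_of_mem_KSub hv' (Finsupp.mem_support_iff.mp hq)))

lemma grTIncl_mem_KSub {n : ℕ} (S : USet n) (v : GrTRep S) : (grTIncl S).hom v ∈ KSub S :=
  (range_grTensor S).le (LinearMap.mem_range_self (grTensor S).toLinearMap v)

/-- The map `⨂ 𝐕_{(i)} → K_S`. -/
def grToK {n : ℕ} (S : USet n) : GrTRep S ⟶ KRep S :=
  Rep.ofHom ⟨(grTIncl S).hom.toLinearMap.codRestrict (KSub S) (grTIncl_mem_KSub S), fun g =>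
    LinearMap.ext fun v => Subtype.ext (Rep.hom_comm_apply (grTIncl S) g v)⟩

lemma grToK_comp_KIncl {n : ℕ} (S : USet n) : grToK S ≫ KIncl S = grTIncl S := rfl

lemma grToK_bijective {n : ℕ} (S : USet n) : Function.Bijective (grToK S).hom := by
  constructor
  · intro v w h
    exact grTensor_injective S (congrArg Subtype.val h)
  · rintro ⟨v, hv⟩
    obtain ⟨w, rfl⟩ := (range_grTensor S).ge hv
    exact ⟨w, rfl⟩

instance {n : ℕ} (S : USet n) : IsIso (grToK S) :=
  have : IsIso ((forget (Rep.{0} ℂ (Gpar n))).map (grToK S)) :=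
    (isIso_iff_bijective _).mpr (grToK_bijective S)
  isIso_of_reflects_iso _ (forget (Rep.{0} ℂ (Gpar n)))

end FlagRep

end

open FlagRep
theorem mainTheorem10 (n : ℕ) (hn : 1 ≤ n) (a : Fin n → ℕ) :
    -- (1) `b ↦ Hom_𝐆(T_a, T_b)` is a `𝒰`-module, and is `P_a = (J_a)^∨`
    IsFiniteModule (homT (USet.ofTuple a)) ∧
    (∃ e : princProj (USet.ofTuple a) ≅ homT (USet.ofTuple a),
      ∀ (b : USet n) (φ : USet.ofTuple a ⟶ b),
        (e.hom.app b).hom (Finsupp.single φ 1) = (TFunctor n).map φ) ∧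
    (∃ e : princProj (USet.ofTuple a) ≅ dualOfD (princInj (USet.ofTuple a).toD),
      ∀ (b : USet n) (φ : USet.ofTuple a ⟶ b),
        (e.hom.app b).hom (Finsupp.single φ 1) =
          Module.Dual.eval ℂ ((b.toD ⟶ (USet.ofTuple a).toD) →₀ ℂ)
            (Finsupp.single (UHom.inv φ) 1)) ∧
    (∀ b : Fin n → ℕ,
      Nontrivial ((TFunctor n).obj (USet.ofTuple a) ⟶ (TFunctor n).obj (USet.ofTuple b)) ↔
        ∑ i, a i = ∑ i, b i ∧ Dominates a b) ∧
    (∀ b : Fin n → ℕ, ∑ i, a i = ∑ i, b i →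
      Module.finrank ℂ
          ((TFunctor n).obj (USet.ofTuple a) ⟶ (TFunctor n).obj (USet.ofTuple b)) =
        (∏ i, (b i).factorial) *
          ∏ i : Fin n with i.val + 1 < n,
            ((∑ j ∈ Finset.Iic i, a j) - ∑ j ∈ Finset.Iio i, b j).choose (b i)) ∧
    -- (2) `K_a = ⨂ᵢ 𝐕_{(i)}^{⊗ aᵢ}` inside `T_a`, as representations of `𝐆`
    (∃ e : GrTRep (USet.ofTuple a) ≅ KRep (USet.ofTuple a),
      e.hom ≫ KIncl (USet.ofTuple a) = grTIncl (USet.ofTuple a)) := by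
  -- The last block exists because `n ≥ 1`.
  have hL : ∀ i : Fin n, i ≤ ⟨n - 1, by omega⟩ := fun i => Fin.le_def.mpr (by simp only; omega)
  refine ⟨isFiniteModule_homT _ hL, ⟨princProjIso _ hL, fun b φ => homMap_single φ⟩,
    ⟨princProjIsoDual _, fun b φ => princProjIsoDual_hom_app_single φ⟩,
    fun b => (nontrivial_hom_iff _ _ hL).trans (nonempty_hom_iff a b),
    fun b h => (finrank_hom _ _ hL).trans (card_hom_eq_choose h),
    ⟨asIso (grToK _), grToK_comp_KIncl _⟩⟩
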